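/- Let $d\ge 2$ be a squarefree integer, let $K=\mathbb{Q}(\sqrt d)$ with ring of integers $\mathcal{O}_K$, and call a prime number $p$ inert if $p\mathcal{O}_K$ is a prime ideal and ramified if $p\mathcal{O}_K$ is the square of a prime ideal. Let $f$ be the product of a nonempty finite set of ramified primes and a (possibly empty) finite set of inert primes. Let $\mathcal{O}$ be the order in $K$ with conductor $f\mathcal{O}_K$ (that is, $\{x\in\mathcal{O}_K : x\mathcal{O}_K\subseteq\mathcal{O}\}=f\mathcal{O}_K$), and assume that the Picard groups satisfy $|\mathrm{Pic}(\mathcal{O})|=|\mathrm{Pic}(\mathcal{O}_K)|=2$. Suppose that every ramified prime $p$ dividing $f$ satisfies at least one of the following, where $\left(\frac{\cdot}{\cdot}\right)$ denotes the Legendre symbol: (i) $p\equiv 1 \pmod 4$ and $\left(\frac{d/p}{p}\right)=-1$; (ii) there is a prime $q\equiv 1\pmod 4$ with $q\mid df$ and $\left(\frac{p}{q}\right)=-1$. Then $\min\Delta(\mathcal{O})=2$; that is, $\Delta(\mathcal{O})$ is nonempty and its least element is $2$. Here $\Delta(\mathcal{O})$ is the set of distances of the multiplicative monoid $\mathcal{O}\setminus\{0\}$: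 for nonzero $a\in\mathcal{O}$ let $\mathsf{L}(a)\subseteq\mathbb{N}_0$ be the set of all $k$ such that $a$ is, up to a unit, a product of $k$ irreducible elements of $\mathcal{O}$; then $\Delta(\mathcal{O})$ is the set of all integers $\delta\ge 1$ such that for some nonzero $a\in\mathcal{O}$ and some $k\in\mathsf{L}(a)$ one has $\mathsf{L}(a)\cap[k,k+\delta]=\{k,k+\delta\}$. -/

import Mathlib

open scoped NumberField nonZeroDivisors

namespace QuadOrder

/-! ### Sets of lengths and sets of distances -/

section Monoids

/-- The set of factorizations of `a`: the elements of the free abelian monoid on the atoms of the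
reduced monoid `H_red = Associates H` whose product is the class of `a`. -/
def factorizations (H : Type*) [CommMonoid H] (a : H) : Set (Multiset (Associates H)) :=
  {z | (∀ u ∈ z, Irreducible u) ∧ z.prod = Associates.mk a}

/-- The set of lengths `L(a)`: all cardinalities (with multiplicity) of factorizations of `a`. -/
def lengths (H : Type*) [CommMonoid H] (a : H) : Set ℕ :=
  Multiset.card '' factorizations H a

/-- The set of distances `Δ(L)` of a set `L` of natural numbers: the positive `δ` such that
`L ∩ [k, k + δ] = {k, k + δ}` for some `k ∈ L`. -/
def distances (L : Set ℕ) : Set ℕ :=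
  {δ | 0 < δ ∧ ∃ k ∈ L, L ∩ Set.Icc k (k + δ) = {k, k + δ}}

/-- The set of distances `Δ(H)` of a monoid: the union of the `Δ(L(a))` over all `a` in `H`. -/
def monoidDistances (H : Type*) [CommMonoid H] : Set ℕ :=
  ⋃ a : H, distances (lengths H a)

/-- The set of distances `Δ(R)` of a domain: that of its multiplicative monoid `R ∖ {0}`. -/
def ringDistances (R : Type*) [CommRing R] [IsDomain R] : Set ℕ :=
  monoidDistances R⁰

end Monoids

/-! ### Orders and ramification -/

section Orders

variable {K : Type*} [Field K]

/-- A subring `O` of the ring of integers of `K` is an order if `K` is its field of fractions and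
the ring of integers is a finitely generated `O`-module. -/
def IsOrder (O : Subring (𝓞 K)) : Prop :=
  IsFractionRing O K ∧ Module.Finite O (𝓞 K)

/-- The conductor `(O : 𝓞 K)` of `O`, as an ideal of the ring of integers. -/
def orderConductor (O : Subring (𝓞 K)) : Ideal (𝓞 K) where
  carrier := {x | ∀ y : 𝓞 K, x * y ∈ O}
  zero_mem' y := by simp
  add_mem' ha hb y := by
    rw [add_mul]
    exact O.add_mem (ha y) (hb y)
  smul_mem' c x hx y := by
    rw [smul_eq_mul, mul_comm c x, mul_assoc]
    exact hx (c * y)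

variable (K)

/-- `p` is an inert prime of `K`: `p 𝓞_K` is a prime ideal. -/
def IsInert (p : ℕ) : Prop :=
  p.Prime ∧ (Ideal.span {(p : 𝓞 K)}).IsPrime

/-- `p` is a ramified prime of the quadratic field `K`: `p 𝓞_K` is the square of a prime ideal. -/
def IsRamified (p : ℕ) : Prop :=
  p.Prime ∧ ∃ P : Ideal (𝓞 K), P.IsPrime ∧ Ideal.span {(p : 𝓞 K)} = P ^ 2

/-- `f` is a nonempty squarefree product of ramified primes times a (possibly empty) squarefree
product of inert primes. -/
def IsRamifiedTimesInert (f : ℕ) : Prop :=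
  ∃ S T : Finset ℕ, S.Nonempty ∧ (∀ p ∈ S, IsRamified K p) ∧ (∀ p ∈ T, IsInert K p) ∧
    f = (∏ p ∈ S, p) * ∏ p ∈ T, p

end Orders

end QuadOrder

/-! ### Integral coordinates on `𝓞 K` and the order as `ℤ + f 𝓞 K` -/

section QuadraticCoordinates

/-! Write `R = 𝓞 K`; the order is `O = ℤ + fR`. Since both Picard groups have order 2, every element
of `R` coprime to `f` has a unit multiple in `O` (`exists_unit_mul_mem_of_card_pic_eq_two`). Hence
`x` has a unit multiple in `O` exactly when, at each prime `p ∣ f`, `x` is coprime to `p` or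
divisible by `p`. This is automatic at inert `p`; at a ramified `p` with `pR = P²` it says that `P`
does not divide `x` exactly once. So factoring in `O` amounts to splitting multisets of prime ideals
that contain evenly many nonprincipal primes and no special prime (a ramified prime over `f`)
exactly once (`balancedTransfer_normalizedFactors`).

The symbol conditions make every special prime nonprincipal, because a generator would have norm
`±p` (`not_isPrincipal_of_span_eq_sq`). Give special primes weight 3, other nonprincipal primes
weight 1 and principal primes weight 2. Every atom then has weight 2 modulo 4
(`Multiset.sum_map_primeWeight_eq_two`), so all lengths of an element have the same parity and the
distance 1 cannot occur.

The distance 2 does occur. With `P` special and `Q` nonprincipal and not special, `P³Q` is an atom,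
and `(P³Q)² = P²·P²·P²·Q²` has lengths 2 and 4 but not 3. -/

theorem not_isSquare_of_squarefree {d : ℕ} (hd : 2 ≤ d) (hdsq : Squarefree d) : ¬ IsSquare d := by
  rintro ⟨r, hr⟩
  have h := Nat.isUnit_iff.1 (hdsq r ⟨1, by rw [hr, mul_one]⟩)
  subst h
  omega

theorem finrank_eq_two_of_sq_eq {d : ℕ} (hd : ¬ IsSquare d)
    {K : Type*} [Field K] [NumberField K] {s : K} (hs : s ^ 2 = (d : K))
    (htop : IntermediateField.adjoin ℚ {s} = ⊤) : Module.finrank ℚ K = 2 := by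
  have hnot : ∀ b : ℚ, b ^ 2 ≠ (d : ℚ) := by
    intro b hb
    have h1 : IsSquare (d : ℚ) := ⟨b, by rw [← hb, sq]⟩
    exact hd (Rat.isSquare_natCast_iff.1 h1)
  have hirr := X_pow_sub_C_irreducible_of_prime Nat.prime_two hnot
  have hmin : minpoly ℚ s = Polynomial.X ^ 2 - Polynomial.C (d : ℚ) := by
    refine (minpoly.eq_of_irreducible_of_monic hirr ?_ ?_).symm
    · simp [hs]
    · exact Polynomial.monic_X_pow_sub_C _ two_ne_zero
  have h := IntermediateField.adjoin.finrank (K := ℚ) (x := s) (Algebra.IsIntegral.isIntegral s)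
  rw [hmin, Polynomial.natDegree_X_pow_sub_C, htop, IntermediateField.finrank_top'] at h
  exact h

/-- A rational algebraic integer lies in `ℤ`, so `𝓞 K / ℤ` is torsion-free of rank one, hence free.
A lift `w` of a generator completes `1` to a `ℤ`-basis, and `w² = n + t w` gives the presentation.
-/
theorem exists_ringEquiv_quadraticAlgebra {K : Type*} [Field K] [NumberField K]
    (h : Module.finrank ℚ K = 2) :
    ∃ n t : ℤ, Nonempty (𝓞 K ≃+* QuadraticAlgebra ℤ n t) := by
  set Z : Submodule ℤ (𝓞 K) := Submodule.span ℤ {1} with hZ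
  have hmem : ∀ x : 𝓞 K, x ∈ Z ↔ ∃ m : ℤ, (m : 𝓞 K) = x := by
    intro x
    rw [hZ, Submodule.mem_span_singleton]
    simp
  have htf : ∀ (m : ℤ) (x : 𝓞 K), m ≠ 0 → m • x ∈ Z → x ∈ Z := by
    intro m x hm hx
    obtain ⟨k, hk⟩ := (hmem _).1 hx
    have h1 : (m : K) * (x : K) = k := by
      have := congrArg (fun z : 𝓞 K => (z : K)) hk
      simp at this
      exact this.symm
    have h2 : algebraMap ℚ K (k / m) = (x : K) := by
      have : (m : K) ≠ 0 := by exact_mod_cast hm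
      simp only [map_div₀, map_intCast]
      rw [div_eq_iff this, ← h1, mul_comm]
    have h3 : IsIntegral ℤ ((k : ℚ) / m) := by
      rw [← isIntegral_algebraMap_iff (algebraMap ℚ K).injective, h2]
      exact x.2
    obtain ⟨l, hl⟩ := IsIntegrallyClosed.isIntegral_iff.1 h3
    refine (hmem _).2 ⟨l, ?_⟩
    apply NumberField.RingOfIntegers.ext
    rw [← h2, ← hl]
    simp
  have : Module.IsTorsionFree ℤ (𝓞 K ⧸ Z) := by
    refine Module.IsTorsionFree.of_smul_eq_zero ?_
    intro m q hq
    by_cases hm : m = 0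
    · exact Or.inl hm
    right
    obtain ⟨x, rfl⟩ := Submodule.Quotient.mk_surjective Z q
    rw [← Submodule.Quotient.mk_smul, Submodule.Quotient.mk_eq_zero] at hq
    exact (Submodule.Quotient.mk_eq_zero Z).2 (htf m x hm hq)
  have : Module.Free ℤ (𝓞 K ⧸ Z) := inferInstance
  have hrank : Module.finrank ℤ (𝓞 K ⧸ Z) = 1 := by
    have h1 := Submodule.finrank_quotient_add_finrank Z
    have h2 : Module.finrank ℤ Z = 1 := by
      rw [← (LinearEquiv.toSpanNonzeroSingleton ℤ (𝓞 K) 1 one_ne_zero).finrank_eq]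
      simp
    rw [NumberField.RingOfIntegers.rank, h, h2] at h1
    omega
  let e : (𝓞 K ⧸ Z) ≃ₗ[ℤ] ℤ := LinearEquiv.ofFinrankEq _ _ (by rw [hrank]; simp)
  obtain ⟨w, hw⟩ := Submodule.Quotient.mk_surjective Z (e.symm 1)
  have key : ∀ x : 𝓞 K, ∃ a b : ℤ, x = a + b * w := by
    intro x
    have h1 : x - e (Submodule.Quotient.mk x) • w ∈ Z := by
      rw [← Submodule.Quotient.mk_eq_zero, Submodule.Quotient.mk_sub, Submodule.Quotient.mk_smul,
        hw, ← map_smul]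
      simp
    obtain ⟨m, hm⟩ := (hmem _).1 h1
    refine ⟨m, e (Submodule.Quotient.mk x), ?_⟩
    rw [hm, zsmul_eq_mul]
    ring
  have inj : ∀ a b : ℤ, (a : 𝓞 K) + b * w = 0 → a = 0 ∧ b = 0 := by
    intro a b hab
    have h1 : e (Submodule.Quotient.mk ((a : 𝓞 K) + b * w)) = b := by
      have : (Submodule.Quotient.mk (a : 𝓞 K) : 𝓞 K ⧸ Z) = 0 :=
        (Submodule.Quotient.mk_eq_zero Z).2 ((hmem _).2 ⟨a, rfl⟩)
      rw [Submodule.Quotient.mk_add, this, zero_add, ← zsmul_eq_mul, Submodule.Quotient.mk_smul, hw,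
        ← map_smul]
      simp
    have hb : b = 0 := by rw [← h1, hab]; simp
    subst hb
    simpa using hab
  obtain ⟨n, t, hnt⟩ := key (w * w)
  refine ⟨n, t, ⟨(RingEquiv.ofBijective
    (QuadraticAlgebra.lift (R := ℤ) (a := n) (b := t) ⟨w, by simp [hnt]⟩) ⟨?_, ?_⟩).symm⟩⟩
  · rw [injective_iff_map_eq_zero]
    intro z hz
    have h1 : ((z.re : ℤ) : 𝓞 K) + z.im * w = 0 := by
      rw [← hz]
      simp [QuadraticAlgebra.lift]
    obtain ⟨h2, h3⟩ := inj _ _ h1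
    ext <;> simp [h2, h3]
  · intro x
    obtain ⟨a, b, rfl⟩ := key x
    exact ⟨⟨a, b⟩, by simp [QuadraticAlgebra.lift]⟩

variable {R : Type*} [CommRing R] {n t : ℤ} (φ : R ≃+* QuadraticAlgebra ℤ n t)

theorem natCast_dvd_iff_coords (m : ℕ) (x : R) :
    (m : R) ∣ x ↔ (m : ℤ) ∣ (φ x).re ∧ (m : ℤ) ∣ (φ x).im := by
  rw [← map_dvd_iff φ, map_natCast, ← QuadraticAlgebra.algebraMap_dvd_iff]
  simp

theorem im_intCast_mul (m : ℤ) (x : R) : (φ (m * x)).im = m * (φ x).im := by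
  rw [map_mul, map_intCast]
  simp

theorem im_natCast_mul (m : ℕ) (x : R) : (φ (m * x)).im = m * (φ x).im := by
  exact_mod_cast im_intCast_mul φ m x

theorem exists_eq_intCast_add_of_dvd_im (m : ℕ) (x : R) (h : (m : ℤ) ∣ (φ x).im) :
    ∃ (a : ℤ) (y : R), x = a + m * y := by
  obtain ⟨c, hc⟩ := h
  refine ⟨(φ x).re, φ.symm ⟨0, c⟩, ?_⟩
  apply φ.injective
  ext <;> simp [hc]

end QuadraticCoordinates

/-- With `ω = φ.symm ⟨0, 1⟩` and `g` the gcd of `f` and the second coordinate of `x ∈ O`, Bézout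
puts `gω` in `O`. Then `g` lies in the conductor, which forces `f ∣ g`. -/
theorem QuadOrder.mem_order_iff_dvd_im {K : Type*} [Field K] {n t : ℤ}
    (φ : 𝓞 K ≃+* QuadraticAlgebra ℤ n t) {f : ℕ} {O : Subring (𝓞 K)}
    (hcond : orderConductor O = Ideal.span {(f : 𝓞 K)}) (x : 𝓞 K) :
    x ∈ O ↔ (f : ℤ) ∣ (φ x).im := by
  have hc : ∀ z : 𝓞 K, (∀ y, z * y ∈ O) ↔ (f : 𝓞 K) ∣ z := by
    intro z
    rw [← Ideal.mem_span_singleton, ← hcond]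
    rfl
  have hf := (hc f).2 dvd_rfl
  constructor
  · intro hx
    have h1 : ((Int.gcd f (φ x).im : ℕ) : 𝓞 K) * φ.symm ⟨0, 1⟩ ∈ O := by
      have h2 : ((Int.gcd f (φ x).im : ℕ) : 𝓞 K) * φ.symm ⟨0, 1⟩ =
          f * (φ.symm ⟨0, 1⟩ * Int.gcdA f (φ x).im) +
            (x * Int.gcdB f (φ x).im - ((φ x).re * Int.gcdB f (φ x).im : ℤ)) := by
        apply φ.injective
        have := Int.gcd_eq_gcd_ab f (φ x).im
        ext
        · simp
        · simp [this]
      rw [h2]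
      exact O.add_mem (hf _) (O.sub_mem (O.mul_mem hx (intCast_mem O _)) (intCast_mem O _))
    have h3 : (f : 𝓞 K) ∣ ((Int.gcd f (φ x).im : ℕ) : 𝓞 K) := by
      rw [← hc]
      intro y
      have h4 : ((Int.gcd f (φ x).im : ℕ) : 𝓞 K) * y =
          ((Int.gcd f (φ x).im : ℕ) * (φ y).re : ℤ) +
            (Int.gcd f (φ x).im : ℕ) * φ.symm ⟨0, 1⟩ * ((φ y).im : ℤ) := by
        apply φ.injective
        ext <;> simp
      rw [h4]
      exact O.add_mem (intCast_mem O _) (O.mul_mem h1 (intCast_mem O _))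
    rw [natCast_dvd_iff_coords φ] at h3
    have h5 : (f : ℤ) ∣ (Int.gcd f (φ x).im : ℕ) := by simpa using h3.1
    exact h5.trans (Int.gcd_dvd_right _ _)
  · intro h
    obtain ⟨a, y, rfl⟩ := exists_eq_intCast_add_of_dvd_im φ f x h
    exact O.add_mem (intCast_mem O _) (hf y)

/-! ### Comparison of the Picard groups of the order and of the maximal order -/

section PicardGroupOfOrder

theorem eq_of_ne_one_of_card_eq_two {G : Type*} [Group G] (h : Nat.card G = 2) {x y : G}
    (hx : x ≠ 1) (hy : y ≠ 1) : x = y :=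
  ((Nat.card_eq_two_iff' (1 : G)).1 h).unique hx hy

theorem card_classGroup_eq_card_pic (R : Type*) [CommRing R] [IsDomain R] :
    Nat.card (ClassGroup R) = Nat.card (CommRing.Pic R) :=
  Nat.card_congr (ClassGroup.equivPic R).toEquiv

theorem Ideal.isPrincipal_mul_iff_of_card_pic_eq_two {R : Type*} [CommRing R] [IsDedekindDomain R]
    (h : Nat.card (CommRing.Pic R) = 2) {I J : Ideal R} (hI : I ≠ 0) (hJ : J ≠ 0) :
    (I * J).IsPrincipal ↔ (I.IsPrincipal ↔ J.IsPrincipal) := by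
  rw [← card_classGroup_eq_card_pic] at h
  have hI' := mem_nonZeroDivisors_of_ne_zero hI
  have hJ' := mem_nonZeroDivisors_of_ne_zero hJ
  rw [← ClassGroup.mk0_eq_one_iff hI', ← ClassGroup.mk0_eq_one_iff hJ',
    ← ClassGroup.mk0_eq_one_iff (mul_mem hI' hJ')]
  have hmul : ClassGroup.mk0 ⟨I * J, mul_mem hI' hJ'⟩ =
      ClassGroup.mk0 ⟨I, hI'⟩ * ClassGroup.mk0 ⟨J, hJ'⟩ := by
    rw [← map_mul]
    rfl
  rw [hmul]
  by_cases h1 : ClassGroup.mk0 ⟨I, hI'⟩ = 1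
  · simp [h1]
  by_cases h2 : ClassGroup.mk0 ⟨J, hJ'⟩ = 1
  · simp [h2]
  · simp only [h1, h2, iff_true]
    have hinv : (ClassGroup.mk0 ⟨J, hJ'⟩)⁻¹ ≠ 1 := by simpa using h2
    rw [eq_of_ne_one_of_card_eq_two h h1 hinv]
    simp

/-- Choose `a` generating `A` modulo `AF` and put `B = aA⁻¹`. This makes every ideal class
representable by an ideal coprime to `F`. -/
theorem Ideal.exists_mul_eq_span_singleton_and_sup_eq_top {R : Type*} [CommRing R]
    [IsDedekindDomain R] {A F : Ideal R} (hA : A ≠ 0) (hF : F ≠ 0) :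
    ∃ (a : R) (B : Ideal R), A * B = Ideal.span {a} ∧ B ⊔ F = ⊤ := by
  obtain ⟨a, ha⟩ := IsDedekindDomain.exists_sup_span_eq (I := A * F) (J := A) Ideal.mul_le_left
    (mul_ne_zero hA hF)
  have h1 : Ideal.span {a} ≤ A := le_sup_right.trans ha.le
  obtain ⟨B, hB⟩ := Ideal.dvd_iff_le.2 h1
  refine ⟨a, B, hB.symm, ?_⟩
  rw [hB, ← Ideal.mul_sup] at ha
  have h2 : A * (F ⊔ B) = A * ⊤ := by rw [ha, Ideal.mul_top]
  rw [sup_comm]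
  exact mul_left_cancel₀ hA h2

variable {R : Type*} [CommRing R] {O : Subring R} {F : Ideal R}

theorem Ideal.comap_subtype_mul_of_sup_eq_top (hF : ∀ x ∈ F, x ∈ O) {A B : Ideal R}
    (hA : A ⊔ F = ⊤) (hB : B ⊔ F = ⊤) :
    (A * B).comap O.subtype = A.comap O.subtype * B.comap O.subtype := by
  apply le_antisymm
  · obtain ⟨a, ha, g, hg, hag⟩ := Submodule.mem_sup.1 ((Ideal.eq_top_iff_one _).1 hA)
    obtain ⟨b, hb, k, hk, hbk⟩ := Submodule.mem_sup.1 ((Ideal.eq_top_iff_one _).1 hB)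
    have haO : a ∈ O := by
      rw [← eq_sub_iff_add_eq] at hag
      rw [hag]
      exact O.sub_mem O.one_mem (hF g hg)
    have hbO : b ∈ O := by
      rw [← eq_sub_iff_add_eq] at hbk
      rw [hbk]
      exact O.sub_mem O.one_mem (hF k hk)
    set w := 1 - a * b with hw
    have hwF : w ∈ F := by
      have : w = g + a * k := by
        rw [hw]
        linear_combination (-1 : R) * hag - a * hbk
      rw [this]
      exact F.add_mem hg (F.mul_mem_left _ hk)
    have key : ∀ z ∈ A * B, ∃ y ∈ A.comap O.subtype * B.comap O.subtype, (y : R) = w ^ 2 * z := by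
      intro z hz
      induction hz using Submodule.mul_induction_on' with
      | mem_mul_mem x hx y hy =>
        refine ⟨⟨w * x, hF _ (F.mul_mem_right _ hwF)⟩ * ⟨w * y, hF _ (F.mul_mem_right _ hwF)⟩,
          Ideal.mul_mem_mul ?_ ?_, ?_⟩
        · exact A.mul_mem_left _ hx
        · exact B.mul_mem_left _ hy
        · simp
          ring
      | add x _ y _ hx hy =>
        obtain ⟨x', hx', hx''⟩ := hx
        obtain ⟨y', hy', hy''⟩ := hy
        exact ⟨x' + y', Ideal.add_mem _ hx' hy', by simp [hx'', hy'', mul_add]⟩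
    intro z hz
    obtain ⟨y, hy, hyz⟩ := key z hz
    have hab : (⟨a, haO⟩ * ⟨b, hbO⟩ : O) ∈ A.comap O.subtype * B.comap O.subtype :=
      Ideal.mul_mem_mul ha hb
    -- Since `ab = 1 - w`, this is `1 = (1 + w)ab + w²` multiplied by `z`. The factor `w²` is what
    -- allows `w² xy = (wx)(wy)` with both factors in `O`.
    have : z = (1 + (1 - ⟨a, haO⟩ * ⟨b, hbO⟩)) * z * (⟨a, haO⟩ * ⟨b, hbO⟩) + y := by
      apply Subtype.ext
      rw [Subring.coe_add, hyz, hw]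
      push_cast
      ring
    rw [this]
    exact Ideal.add_mem _ (Ideal.mul_mem_left _ _ hab) hy
  · rw [Ideal.mul_le]
    intro x hx y hy
    exact Ideal.mul_mem_mul hx hy

theorem Ideal.map_comap_subtype_of_sup_eq_top (hF : ∀ x ∈ F, x ∈ O) {A : Ideal R}
    (hA : A ⊔ F = ⊤) : (A.comap O.subtype).map O.subtype = A := by
  apply le_antisymm Ideal.map_comap_le
  obtain ⟨a, ha, g, hg, hag⟩ := Submodule.mem_sup.1 ((Ideal.eq_top_iff_one _).1 hA)
  have haO : a ∈ O := by
    have := eq_sub_iff_add_eq.2 hag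
    rw [this]
    exact O.sub_mem O.one_mem (hF g hg)
  intro z hz
  have h1 : z = z * a + g * z := by linear_combination (-z) * hag
  rw [h1]
  refine Ideal.add_mem _ (Ideal.mul_mem_left _ _ ?_) ?_
  · exact Ideal.mem_map_of_mem O.subtype (show (⟨a, haO⟩ : O) ∈ A.comap O.subtype from ha)
  · exact Ideal.mem_map_of_mem O.subtype (show (⟨g * z, hF _ (F.mul_mem_right _ hg)⟩ : O) ∈
      A.comap O.subtype from A.mul_mem_left _ hz)

theorem Ideal.comap_subtype_span_singleton (hF : ∀ x ∈ F, x ∈ O) (c : O) (hc : 1 - (c : R) ∈ F) :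
    (Ideal.span {(c : R)}).comap O.subtype = Ideal.span {c} := by
  apply le_antisymm
  · intro z hz
    obtain ⟨r, hr⟩ := Ideal.mem_span_singleton'.1 (Ideal.mem_comap.1 hz)
    have hr' : r * c = (z : R) := hr
    have h1 : r = z + r * (1 - c) := by
      linear_combination hr'
    have hrO : r ∈ O := by
      rw [h1]
      exact O.add_mem z.2 (hF _ (F.mul_mem_left _ hc))
    exact Ideal.mem_span_singleton'.2 ⟨⟨r, hrO⟩, Subtype.ext hr⟩
  · rw [Ideal.span_singleton_le_iff_mem]
    exact Ideal.mem_span_singleton_self _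

theorem FractionalIdeal.isUnit_coeIdeal_of_mul_eq_span_singleton {S : Type*} [CommRing S]
    [IsDomain S] {I J : Ideal S} {c : S} (hc : c ≠ 0) (h : I * J = Ideal.span {c}) :
    IsUnit (I : FractionalIdeal S⁰ (FractionRing S)) := by
  have h1 : (I : FractionalIdeal S⁰ (FractionRing S)) * J =
      FractionalIdeal.spanSingleton S⁰ (algebraMap S (FractionRing S) c) := by
    rw [← FractionalIdeal.coeIdeal_mul, h, FractionalIdeal.coeIdeal_span_singleton]
  refine isUnit_of_mul_isUnit_left (y := (J : FractionalIdeal S⁰ (FractionRing S))) ?_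
  rw [h1]
  refine IsUnit.of_mul_eq_one
    (FractionalIdeal.spanSingleton S⁰ (algebraMap S (FractionRing S) c)⁻¹) ?_
  rw [FractionalIdeal.spanSingleton_mul_spanSingleton, mul_inv_cancel₀, FractionalIdeal.spanSingleton_one]
  simpa using hc

/-- Contractions of ideals coprime to `F` are invertible in `O`: scale the complementary ideal by
`b` so that the generator `ab` becomes `1` modulo `F`. Then `ab ∈ O` generates its own contraction.
-/
theorem Ideal.exists_comap_mul_eq_span_singleton [IsDedekindDomain R] (hF : ∀ x ∈ F, x ∈ O)
    (hF0 : F ≠ 0) (hF1 : F ≠ ⊤) {A : Ideal R} (hA0 : A ≠ 0) (hA : A ⊔ F = ⊤) :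
    ∃ (J : Ideal O) (c : O), c ≠ 0 ∧ A.comap O.subtype * J = Ideal.span {c} := by
  obtain ⟨a, B, hab, hB⟩ := Ideal.exists_mul_eq_span_singleton_and_sup_eq_top hA0 hF0
  have ha : Ideal.span {a} ⊔ F = ⊤ := by
    rw [← hab, Ideal.mul_sup_eq_of_coprime_left hA, hB]
  obtain ⟨c, hc, g, hg, hcg⟩ := Submodule.mem_sup.1 ((Ideal.eq_top_iff_one _).1 ha)
  obtain ⟨b, rfl⟩ := Ideal.mem_span_singleton.1 hc
  have hcg' := eq_sub_iff_add_eq.2 hcg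
  have hcO : a * b ∈ O := by
    rw [hcg']
    exact O.sub_mem O.one_mem (hF g hg)
  have hb : Ideal.span {b} ⊔ F = ⊤ := by
    rw [Ideal.eq_top_iff_one, ← hcg]
    exact Ideal.add_mem _ (Ideal.mem_sup_left (Ideal.mul_mem_left _ _
      (Ideal.mem_span_singleton_self b))) (Ideal.mem_sup_right hg)
  have hBb : B * Ideal.span {b} ⊔ F = ⊤ := by
    rw [Ideal.mul_sup_eq_of_coprime_left hB, hb]
  refine ⟨(B * Ideal.span {b}).comap O.subtype, ⟨a * b, hcO⟩, ?_, ?_⟩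
  · intro h0
    apply hF1
    have h1 : a * b = 0 := congrArg Subtype.val h0
    rw [h1, zero_add] at hcg
    rw [Ideal.eq_top_iff_one, ← hcg]
    exact hg
  · rw [← Ideal.comap_subtype_mul_of_sup_eq_top hF hA hBb, ← mul_assoc, hab,
      Ideal.span_singleton_mul_span_singleton]
    refine Ideal.comap_subtype_span_singleton hF ⟨a * b, hcO⟩ ?_
    have : 1 - a * b = g := by linear_combination -hcg
    exact this ▸ hg

/-- Let `B` be nonprincipal and coprime to `F`. Extension to `R` undoes contraction, so `B ∩ O` is
nonprincipal and its class differs from that of `xR ∩ O`. As there are only two classes, `xR ∩ O` is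
principal, and its generator generates `xR` as well. -/
theorem exists_unit_mul_mem_of_card_pic_eq_two [IsDedekindDomain R] (hF : ∀ x ∈ F, x ∈ O)
    (hF0 : F ≠ 0) (hF1 : F ≠ ⊤) (hO : Nat.card (CommRing.Pic O) = 2)
    (hR : Nat.card (CommRing.Pic R) = 2) {x : R} (hx : Ideal.span {x} ⊔ F = ⊤) :
    ∃ u : Rˣ, u * x ∈ O := by
  have hx0 : x ≠ 0 := by
    rintro rfl
    apply hF1
    simpa using hx
  obtain ⟨B, hB0, hBF, hBp⟩ : ∃ B : Ideal R, B ≠ 0 ∧ B ⊔ F = ⊤ ∧ ¬ B.IsPrincipal := by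
    have h1 := hR
    rw [← card_classGroup_eq_card_pic] at h1
    obtain ⟨g, hg, -⟩ := (Nat.card_eq_two_iff' (1 : ClassGroup R)).1 h1
    obtain ⟨⟨J, hJ⟩, rfl⟩ := ClassGroup.mk0_surjective g
    rw [ne_eq, ClassGroup.mk0_eq_one_iff] at hg
    have hJ0 := nonZeroDivisors.ne_zero hJ
    obtain ⟨a, B, hab, hB⟩ := Ideal.exists_mul_eq_span_singleton_and_sup_eq_top hJ0 hF0
    have hB0 : B ≠ 0 := by
      rintro rfl
      apply hF1
      simpa using hB
    refine ⟨B, hB0, hB, fun h => hg ?_⟩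
    have h2 : (J * B).IsPrincipal := by
      rw [hab]
      exact ⟨⟨a, rfl⟩⟩
    exact ((Ideal.isPrincipal_mul_iff_of_card_pic_eq_two hR hJ0 hB0).1 h2).2 h
  have hA0 : Ideal.span {x} ≠ 0 := by simpa using hx0
  obtain ⟨J₁, c₁, hc₁, h₁⟩ := Ideal.exists_comap_mul_eq_span_singleton hF hF0 hF1 hA0 hx
  obtain ⟨J₂, c₂, hc₂, h₂⟩ := Ideal.exists_comap_mul_eq_span_singleton hF hF0 hF1 hB0 hBF
  obtain ⟨u₁, hu₁⟩ := FractionalIdeal.isUnit_coeIdeal_of_mul_eq_span_singleton hc₁ h₁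
  obtain ⟨u₂, hu₂⟩ := FractionalIdeal.isUnit_coeIdeal_of_mul_eq_span_singleton hc₂ h₂
  have hne₂ : ClassGroup.mk (FractionRing O) u₂ ≠ 1 := by
    rw [ne_eq, ClassGroup.mk_eq_one_of_coe_ideal hu₂]
    rintro ⟨y, -, hy⟩
    apply hBp
    rw [← Ideal.map_comap_subtype_of_sup_eq_top hF hBF, hy, Ideal.map_span]
    simp only [Set.image_singleton]
    exact ⟨⟨_, rfl⟩⟩
  have hne : ClassGroup.mk (FractionRing O) u₁ ≠ ClassGroup.mk (FractionRing O) u₂ := by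
    rw [ne_eq, ClassGroup.mk_eq_mk_of_coe_ideal hu₁ hu₂]
    rintro ⟨y, z, hy, hz, hyz⟩
    apply hBp
    have h3 := congrArg (Ideal.map O.subtype) hyz
    rw [Ideal.map_mul, Ideal.map_mul, Ideal.map_comap_subtype_of_sup_eq_top hF hBF,
      Ideal.map_comap_subtype_of_sup_eq_top hF hx, Ideal.map_span, Ideal.map_span] at h3
    simp only [Set.image_singleton, Ideal.span_singleton_mul_span_singleton] at h3
    have hz' : Ideal.span {O.subtype z} ≠ 0 := by simpa using hz
    have h4 : (Ideal.span {O.subtype z} * B).IsPrincipal := by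
      rw [← h3]
      exact ⟨⟨_, rfl⟩⟩
    exact ((Ideal.isPrincipal_mul_iff_of_card_pic_eq_two hR hz' hB0).1 h4).1 ⟨⟨_, rfl⟩⟩
  have hone : ClassGroup.mk (FractionRing O) u₁ = 1 := by
    by_contra h
    rw [← card_classGroup_eq_card_pic] at hO
    exact hne (eq_of_ne_one_of_card_eq_two hO h hne₂)
  obtain ⟨y, -, hy⟩ := (ClassGroup.mk_eq_one_of_coe_ideal hu₁).1 hone
  have h5 := Ideal.map_comap_subtype_of_sup_eq_top hF hx
  rw [hy, Ideal.map_span] at h5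
  simp only [Set.image_singleton] at h5
  obtain ⟨u, hu⟩ := (Ideal.span_singleton_eq_span_singleton.1 h5).symm
  refine ⟨u, ?_⟩
  rw [mul_comm, hu]
  exact y.2

end PicardGroupOfOrder

/-! ### Moving elements and factorizations into the order by units -/

section Transfer

/-- At every prime divisor `p` of `f`, the element `x` is either coprime to `p` or divisible
by `p`. -/
def AdmissibleAt {R : Type*} [CommRing R] (f : ℕ) (x : R) : Prop :=
  ∀ p : ℕ, p.Prime → p ∣ f → IsCoprime x (p : R) ∨ (p : R) ∣ x

theorem natCast_isCoprime_of_coprime {R : Type*} [CommRing R] {a b : ℕ} (h : a.Coprime b) :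
    IsCoprime (a : R) (b : R) := by
  have := (Nat.isCoprime_iff_coprime.2 h).map (Int.castRingHom R)
  simpa using this

theorem exists_forall_prime_dvd_sub {R : Type*} [CommRing R] {f : ℕ} (hf : f ≠ 0) (x : ℕ → R) :
    ∃ z : R, ∀ p : ℕ, p.Prime → p ∣ f → (p : R) ∣ z - x p := by
  let I : f.primeFactors → Ideal R := fun p => Ideal.span {((p : ℕ) : R)}
  have hI : Pairwise fun i j => IsCoprime (I i) (I j) := by
    intro i j hij
    rw [Ideal.isCoprime_span_singleton_iff]
    apply natCast_isCoprime_of_coprime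
    rw [Nat.coprime_primes (Nat.prime_of_mem_primeFactors i.2) (Nat.prime_of_mem_primeFactors j.2)]
    exact fun h => hij (Subtype.ext h)
  obtain ⟨z, hz⟩ := Ideal.pi_quotient_surjective hI fun i => x i
  refine ⟨z, fun p hp hpf => ?_⟩
  have := hz ⟨p, Nat.mem_primeFactors.2 ⟨hp, hpf, hf⟩⟩
  rwa [Ideal.Quotient.eq, Ideal.mem_span_singleton] at this

theorem isCoprime_natCast_of_forall_prime {R : Type*} [CommRing R] {f : ℕ} (hf : Squarefree f)
    {x : R} (h : ∀ p : ℕ, p.Prime → p ∣ f → IsCoprime x (p : R)) : IsCoprime x (f : R) := by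
  rw [← Nat.prod_primeFactors_of_squarefree hf, Nat.cast_prod]
  exact IsCoprime.prod_right fun p hp =>
    h p (Nat.prime_of_mem_primeFactors hp) (Nat.dvd_of_mem_primeFactors hp)

theorem natCast_dvd_of_forall_prime {R : Type*} [CommRing R] {f : ℕ} (hf : Squarefree f)
    {x : R} (h : ∀ p : ℕ, p.Prime → p ∣ f → (p : R) ∣ x) : (f : R) ∣ x := by
  rw [← Nat.prod_primeFactors_of_squarefree hf, Nat.cast_prod]
  refine Finset.prod_dvd_of_coprime ?_ fun p hp =>
    h p (Nat.prime_of_mem_primeFactors hp) (Nat.dvd_of_mem_primeFactors hp)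
  intro p hp q hq hpq
  exact natCast_isCoprime_of_coprime ((Nat.coprime_primes (Nat.prime_of_mem_primeFactors hp)
    (Nat.prime_of_mem_primeFactors hq)).2 hpq)

variable {R : Type*} [CommRing R] {n t : ℤ} (φ : R ≃+* QuadraticAlgebra ℤ n t)

include φ in
theorem not_isUnit_natCast_of_prime {p : ℕ} (hp : p.Prime) : ¬ IsUnit (p : R) := by
  intro h
  have h1 := (natCast_dvd_iff_coords φ p 1).1 h.dvd
  simp only [map_one, QuadraticAlgebra.re_one] at h1
  have := Int.natCast_dvd_natCast.1 (by simpa using h1.1 : (p : ℤ) ∣ (1 : ℕ))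
  exact hp.one_lt.ne' (Nat.dvd_one.1 this)

include φ in
theorem not_isCoprime_natCast_of_dvd {p : ℕ} (hp : p.Prime) {x : R} (h : (p : R) ∣ x) :
    ¬ IsCoprime x (p : R) := fun hc =>
  not_isUnit_natCast_of_prime φ hp (hc.isUnit_of_dvd' h dvd_rfl)

/-- Modulo `p`, `x` is a nonzero rational integer `a`, so the second coordinate of `xy` is `a` times
that of `y`. -/
theorem prime_dvd_im_of_dvd_im_mul {p : ℕ} (hp : p.Prime) {x y : R}
    (hx : (p : ℤ) ∣ (φ x).im) (hxp : IsCoprime x (p : R)) (hxy : (p : ℤ) ∣ (φ (x * y)).im) :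
    (p : ℤ) ∣ (φ y).im := by
  obtain ⟨a, z, rfl⟩ := exists_eq_intCast_add_of_dvd_im φ p x hx
  have h1 : (φ ((a + p * z) * y)).im = a * (φ y).im + p * (φ (z * y)).im := by
    rw [← im_intCast_mul, ← im_natCast_mul, ← QuadraticAlgebra.im_add, ← map_add]
    congr 2
    ring
  rw [h1, dvd_add_left (dvd_mul_right _ _)] at hxy
  refine ((Nat.prime_iff_prime_int.1 hp).dvd_or_dvd hxy).resolve_left fun h => ?_
  refine not_isCoprime_natCast_of_dvd φ hp ?_ hxp
  refine dvd_add ?_ (dvd_mul_right _ _)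
  have := map_dvd (Int.castRingHom R) h
  simpa using this

theorem dvd_im_of_natCast_dvd {p : ℕ} {x : R} (h : (p : R) ∣ x) : (p : ℤ) ∣ (φ x).im :=
  ((natCast_dvd_iff_coords φ p x).1 h).2

variable {f : ℕ} {O : Subring R}

include φ in
theorem admissibleAt_of_mem (hO : ∀ x, x ∈ O ↔ (f : ℤ) ∣ (φ x).im) {x : R} (hx : x ∈ O) :
    AdmissibleAt f x := by
  intro p hp hpf
  obtain ⟨a, z, rfl⟩ := exists_eq_intCast_add_of_dvd_im φ p x
    ((Int.natCast_dvd_natCast.2 hpf).trans ((hO x).1 hx))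
  by_cases h : (p : ℤ) ∣ a
  · right
    refine dvd_add ?_ (dvd_mul_right _ _)
    have := map_dvd (Int.castRingHom R) h
    simpa using this
  · left
    have h1 : IsCoprime a (p : ℤ) :=
      ((Nat.prime_iff_prime_int.1 hp).coprime_iff_not_dvd.2 h).symm
    have h2 := h1.map (Int.castRingHom R)
    simp only [eq_intCast, Int.cast_natCast] at h2
    exact (IsCoprime.add_mul_left_left_iff).2 h2

include φ in
-- A single unit must serve both factors. At each `p ∣ f` there is a `z` coprime to `p` such that
-- `uz ∈ ℤ + pR` suffices for `ux` and `u⁻¹y`: take `x` if it is coprime to `p`, otherwise an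
-- inverse of `y` modulo `p`, and `1` if `p` divides both. The Chinese remainder theorem glues
-- these, and `hu` supplies `u`.
theorem exists_unit_mul_mem_and_inv_mul_mem (hf : Squarefree f)
    (hO : ∀ x, x ∈ O ↔ (f : ℤ) ∣ (φ x).im)
    (hu : ∀ x : R, IsCoprime x (f : R) → ∃ u : Rˣ, u * x ∈ O) {x y : R}
    (hx : AdmissibleAt f x) (hy : AdmissibleAt f y) (hxy : x * y ∈ O) :
    ∃ u : Rˣ, u * x ∈ O ∧ (u⁻¹ : Rˣ) * y ∈ O := by
  have local_exists : ∀ p : ℕ, ∃ z : R, p.Prime → p ∣ f → IsCoprime z (p : R) ∧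
      ∀ u : Rˣ, (p : ℤ) ∣ (φ (u * z)).im →
        (p : ℤ) ∣ (φ (u * x)).im ∧ (p : ℤ) ∣ (φ ((u⁻¹ : Rˣ) * y)).im := by
    intro p
    by_cases hpf : p.Prime ∧ p ∣ f
    swap
    · exact ⟨0, fun h1 h2 => (hpf ⟨h1, h2⟩).elim⟩
    obtain ⟨hp, hpf⟩ := hpf
    have hxyp : (p : ℤ) ∣ (φ (x * y)).im :=
      (Int.natCast_dvd_natCast.2 hpf).trans ((hO _).1 hxy)
    rcases hx p hp hpf with hxc | hxd
    · refine ⟨x, fun _ _ => ⟨hxc, fun u hux => ⟨hux, ?_⟩⟩⟩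
      refine prime_dvd_im_of_dvd_im_mul φ hp hux ((isCoprime_mul_unit_left_left u.isUnit _ _).2 hxc) ?_
      rwa [show (u : R) * x * ((u⁻¹ : Rˣ) * y) = x * y by
        rw [mul_mul_mul_comm, Units.mul_inv, one_mul]]
    · rcases hy p hp hpf with hyc | hyd
      · obtain ⟨y', b, hb⟩ := hyc
        have hyc' : IsCoprime y' (p : R) := ⟨y, b, by rw [mul_comm y, hb]⟩
        refine ⟨y', fun _ _ => ⟨hyc', fun u huy => ⟨dvd_im_of_natCast_dvd φ (hxd.mul_left _), ?_⟩⟩⟩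
        refine prime_dvd_im_of_dvd_im_mul φ hp huy
          ((isCoprime_mul_unit_left_left u.isUnit _ _).2 hyc') ?_
        rw [show (u : R) * y' * ((u⁻¹ : Rˣ) * y) = ((1 : ℤ) : R) + p * (-b) by
          rw [mul_mul_mul_comm, Units.mul_inv, one_mul]
          push_cast
          linear_combination hb, map_add, QuadraticAlgebra.im_add, im_natCast_mul, map_intCast,
          QuadraticAlgebra.im_intCast, zero_add]
        exact dvd_mul_right _ _
      · exact ⟨1, fun _ _ => ⟨isCoprime_one_left, fun u _ =>
          ⟨dvd_im_of_natCast_dvd φ (hxd.mul_left _), dvd_im_of_natCast_dvd φ (hyd.mul_left _)⟩⟩⟩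
  choose w hw using local_exists
  obtain ⟨z, hz⟩ := exists_forall_prime_dvd_sub hf.ne_zero w
  have hzc : IsCoprime z (f : R) := by
    refine isCoprime_natCast_of_forall_prime hf fun p hp hpf => ?_
    obtain ⟨c, hc⟩ := hz p hp hpf
    rw [sub_eq_iff_eq_add'] at hc
    rw [hc]
    exact (IsCoprime.add_mul_left_left_iff).2 (hw p hp hpf).1
  obtain ⟨u, hu⟩ := hu z hzc
  have hloc : ∀ p : ℕ, p.Prime → p ∣ f →
      (p : ℤ) ∣ (φ (u * x)).im ∧ (p : ℤ) ∣ (φ ((u⁻¹ : Rˣ) * y)).im := by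
    intro p hp hpf
    refine (hw p hp hpf).2 u ?_
    have h1 : (p : ℤ) ∣ (φ (u * z)).im := (Int.natCast_dvd_natCast.2 hpf).trans ((hO _).1 hu)
    have h2 : (p : ℤ) ∣ (φ (u * (z - w p))).im := dvd_im_of_natCast_dvd φ ((hz p hp hpf).mul_left _)
    have h3 : (φ (u * w p)).im = (φ (u * z)).im - (φ (u * (z - w p))).im := by
      rw [← QuadraticAlgebra.im_sub, ← map_sub]
      congr 2
      ring
    rw [h3]
    exact dvd_sub h1 h2
  refine ⟨u, (hO _).2 ?_, (hO _).2 ?_⟩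
  · exact_mod_cast natCast_dvd_of_forall_prime hf fun p hp hpf => by
      exact_mod_cast (hloc p hp hpf).1
  · exact_mod_cast natCast_dvd_of_forall_prime hf fun p hp hpf => by
      exact_mod_cast (hloc p hp hpf).2

include φ in
theorem exists_unit_mul_mem_of_admissibleAt (hf : Squarefree f)
    (hO : ∀ x, x ∈ O ↔ (f : ℤ) ∣ (φ x).im)
    (hu : ∀ x : R, IsCoprime x (f : R) → ∃ u : Rˣ, u * x ∈ O) {x : R}
    (hx : AdmissibleAt f x) : ∃ u : Rˣ, u * x ∈ O := by
  -- The partner `f` is admissible, being divisible by every `p ∣ f`, and `x * f ∈ O` for every `x`.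
  obtain ⟨u, h, -⟩ := exists_unit_mul_mem_and_inv_mul_mem φ hf hO hu hx
    (y := (f : R)) (fun p _ hpf => Or.inr (Nat.cast_dvd_cast hpf))
    ((hO _).2 (dvd_im_of_natCast_dvd φ (dvd_mul_left _ _)))
  exact ⟨u, h⟩

include φ in
theorem isUnit_of_isUnit_coe (hf : Squarefree f) (hO : ∀ x, x ∈ O ↔ (f : ℤ) ∣ (φ x).im) {x : O}
    (hx : IsUnit (x : R)) : IsUnit x := by
  obtain ⟨y, hy⟩ := hx.exists_right_inv
  have hyO : y ∈ O := by
    rw [hO]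
    have h : ∀ p : ℕ, p.Prime → p ∣ f → (p : ℤ) ∣ (φ y).im := by
      intro p hp hpf
      refine prime_dvd_im_of_dvd_im_mul φ hp ((Int.natCast_dvd_natCast.2 hpf).trans
        ((hO _).1 x.2)) ⟨y, 0, by rw [mul_comm y, hy]; simp⟩ ?_
      rw [hy, ← Int.cast_one, map_intCast, QuadraticAlgebra.im_intCast]
      exact dvd_zero _
    exact_mod_cast natCast_dvd_of_forall_prime hf fun p hp hpf => by exact_mod_cast h p hp hpf
  exact IsUnit.of_mul_eq_one ⟨y, hyO⟩ (Subtype.ext hy)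

end Transfer

/-! ### Norm residues: special primes are nonprincipal -/

section NormObstruction

theorem ZMod.isSquare_neg_of_isSquare {q : ℕ} [Fact q.Prime] (hq : q % 4 = 1) {x : ZMod q}
    (h : IsSquare (-x)) : IsSquare x := by
  have h1 : IsSquare (-1 : ZMod q) := ZMod.exists_sq_eq_neg_one_iff.2 (by omega)
  have := h1.mul h
  simpa using this

/-- Otherwise the squares are stable under subtracting `d`. Starting from `0`, every `-kd` is then a
square, and these exhaust `ZMod q`. -/
theorem ZMod.exists_not_isSquare_sq_sub {q : ℕ} [Fact q.Prime] (hq : q % 4 = 1) {d : ZMod q}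
    (hd : d ≠ 0) : ∃ x : ZMod q, ¬ IsSquare (x ^ 2 - d) := by
  by_contra! h
  obtain ⟨a, ha⟩ := FiniteField.exists_nonsquare (F := ZMod q) (by
    rw [ZMod.ringChar_zmod_n]
    rintro rfl
    omega)
  have hk : ∀ k : ℕ, IsSquare (-((k : ZMod q) * d)) := by
    intro k
    induction k with
    | zero => simp
    | succ k ih =>
      obtain ⟨r, hr⟩ := ih
      have := h r
      rw [sq, ← hr] at this
      convert! this using 1
      push_cast
      ring
  apply ha
  have := hk (-(a / d)).val
  rw [ZMod.natCast_val, ZMod.cast_id] at this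
  rwa [neg_mul, neg_neg, div_mul_cancel₀ _ hd] at this

variable {R : Type*} [CommRing R] {n t : ℤ} (φ : R ≃+* QuadraticAlgebra ℤ n t)

theorem norm_units_eq_one_or_neg_one (u : Rˣ) : (φ u).norm = 1 ∨ (φ u).norm = -1 :=
  Int.isUnit_iff.1 ((u.isUnit.map φ).map QuadraticAlgebra.norm)

theorem dvd_norm_sub_norm {q : ℕ} {x y : R} (h : (q : R) ∣ x - y) :
    (q : ℤ) ∣ (φ x).norm - (φ y).norm := by
  obtain ⟨z, hz⟩ := h
  rw [sub_eq_iff_eq_add'] at hz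
  subst hz
  refine ⟨(φ z).re * (2 * (φ y).re + t * (φ y).im) + (φ z).im * (t * (φ y).re - 2 * n * (φ y).im)
    + q * (φ z).norm, ?_⟩
  simp only [QuadraticAlgebra.norm_def, map_add, map_mul, map_natCast, QuadraticAlgebra.re_add,
    QuadraticAlgebra.im_add, QuadraticAlgebra.re_mul, QuadraticAlgebra.im_mul,
    QuadraticAlgebra.re_natCast, QuadraticAlgebra.im_natCast]
  ring

section SqrtCoordinates

variable {d : ℕ} {s : R} (hs : s ^ 2 = (d : R))

include hs

theorem re_sq_add_mul_im_sq : (φ s).re ^ 2 + n * (φ s).im ^ 2 = d := by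
  have h := congrArg (fun z => (φ z).re) hs
  simp only [sq, map_mul, map_natCast, QuadraticAlgebra.re_mul, QuadraticAlgebra.re_natCast] at h
  linear_combination h

variable (hd : ¬ IsSquare d)

include hd

theorem im_sqrt_ne_zero : (φ s).im ≠ 0 := by
  intro h
  have h1 := re_sq_add_mul_im_sq φ hs
  rw [h] at h1
  apply hd
  rw [← Int.isSquare_natCast_iff]
  exact ⟨(φ s).re, by rw [← h1]; ring⟩

theorem two_mul_re_sqrt : 2 * (φ s).re = - (t * (φ s).im) := by
  have h := congrArg (fun z => (φ z).im) hs
  simp only [sq, map_mul, map_natCast, QuadraticAlgebra.im_mul, QuadraticAlgebra.im_natCast] at h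
  apply mul_right_cancel₀ (im_sqrt_ne_zero φ hs hd)
  linear_combination h

theorem im_sqrt_sq_mul_norm (x : R) : (φ s).im ^ 2 * (φ x).norm =
    ((φ s).im * (φ x).re - (φ s).re * (φ x).im) ^ 2 - d * (φ x).im ^ 2 := by
  have h1 := re_sq_add_mul_im_sq φ hs
  have h2 := two_mul_re_sqrt φ hs hd
  rw [QuadraticAlgebra.norm_def]
  linear_combination -(φ x).im ^ 2 * h1 + (φ s).im * (φ x).re * (φ x).im * h2

theorem norm_intCast_add_sqrt (x : ℤ) : (φ (x + s)).norm = x ^ 2 - d := by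
  have h1 := re_sq_add_mul_im_sq φ hs
  have h2 := two_mul_re_sqrt φ hs hd
  simp only [QuadraticAlgebra.norm_def, map_add, map_intCast, QuadraticAlgebra.re_add,
    QuadraticAlgebra.im_add, QuadraticAlgebra.re_intCast, QuadraticAlgebra.im_intCast]
  push_cast
  linear_combination (-1 : ℤ) * h1 + (x + (φ s).re) * h2

/-- Such a `q` would divide both coordinates of `s`, hence `q² ∣ d`. This makes the second
coordinate of `s` invertible modulo `q` in `im_sqrt_sq_mul_norm`. -/
theorem not_dvd_im_sqrt (hdsq : Squarefree d) {q : ℕ} (hq : q.Prime) (hq2 : q ≠ 2) :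
    ¬ (q : ℤ) ∣ (φ s).im := by
  intro h
  have h1 := re_sq_add_mul_im_sq φ hs
  have h2 := two_mul_re_sqrt φ hs hd
  have hqp := Nat.prime_iff_prime_int.1 hq
  have h3 : (q : ℤ) ∣ (φ s).re := by
    have : (q : ℤ) ∣ 2 * (φ s).re := by
      rw [h2, dvd_neg]
      exact h.mul_left _
    refine (hqp.dvd_or_dvd this).resolve_left fun h4 => hq2 ?_
    exact (Nat.prime_dvd_prime_iff_eq hq Nat.prime_two).1 (by exact_mod_cast h4)
  have h4 : (q : ℤ) * q ∣ d := by
    rw [← h1, sq, sq]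
    exact dvd_add (mul_dvd_mul h3 h3) ((mul_dvd_mul h h).mul_left _)
  exact hq.one_lt.ne' (Nat.isUnit_iff.1 (hdsq q (by exact_mod_cast h4)))

end SqrtCoordinates

theorem norm_eq_or_eq_neg_of_associated_sq {p : ℕ} {x : R} (h : Associated (p : R) (x ^ 2)) :
    (φ x).norm = p ∨ (φ x).norm = -p := by
  obtain ⟨u, hu⟩ := h
  have h1 := congrArg (fun z => (φ z).norm) hu
  simp only [map_mul, map_pow, map_natCast, QuadraticAlgebra.norm_natCast] at h1
  rw [← sq_eq_sq_iff_eq_or_eq_neg]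
  rcases norm_units_eq_one_or_neg_one φ u with h2 | h2
  · rw [h2] at h1
    linear_combination (-1 : ℤ) * h1
  · rw [h2] at h1
    nlinarith [sq_nonneg (φ x).norm, sq_nonneg (p : ℤ)]

variable {d : ℕ} {s : R}

/-- As `q ∣ d`, the identity `im_sqrt_sq_mul_norm` makes the norm a square modulo `q`. The sign is
harmless because `-1` is a square. -/
theorem isSquare_natCast_of_norm_eq (hs : s ^ 2 = (d : R)) (hd : ¬ IsSquare d)
    (hdsq : Squarefree d) {p q : ℕ} [Fact q.Prime] (hq : q % 4 = 1) (hqd : q ∣ d) {x : R}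
    (hx : (φ x).norm = p ∨ (φ x).norm = -p) : IsSquare (p : ZMod q) := by
  have hqp : q.Prime := Fact.out
  have hb := not_dvd_im_sqrt φ hs hd hdsq hqp (by rintro rfl; omega)
  rw [← ZMod.intCast_zmod_eq_zero_iff_dvd] at hb
  have h1 := im_sqrt_sq_mul_norm φ hs hd x
  set b := (φ s).im
  set X := b * (φ x).re - (φ s).re * (φ x).im
  have hd0 : (d : ZMod q) = 0 := (ZMod.natCast_eq_zero_iff d q).2 hqd
  have h2 := congrArg (Int.cast : ℤ → ZMod q) h1
  push_cast at h2
  rw [hd0, zero_mul, sub_zero] at h2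
  rcases hx with hx | hx
  · rw [hx] at h2
    push_cast at h2
    refine ⟨X / b, ?_⟩
    field_simp
    linear_combination h2
  · rw [hx] at h2
    push_cast at h2
    refine ZMod.isSquare_neg_of_isSquare hq ⟨X / b, ?_⟩
    field_simp
    linear_combination h2

include φ in
-- Put `y = (φ x).im`. Then `p ∤ y`, as otherwise `p²` divides the norm `±p`. In `b² N(x) = X² - d
-- y²` both `X` and `d` turn out divisible by `p`; dividing by `p` and reducing gives `b² ≡ ∓(d/p)
-- y²`.
theorem isSquare_natCast_div_of_associated_sq (hs : s ^ 2 = (d : R)) (hd : ¬ IsSquare d)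
    (hdsq : Squarefree d) {p : ℕ} [Fact p.Prime] (hp : p % 4 = 1) {x : R}
    (hx : Associated (p : R) (x ^ 2)) : IsSquare ((d / p : ℕ) : ZMod p) := by
  have hpp : p.Prime := Fact.out
  have hpi := Nat.prime_iff_prime_int.1 hpp
  have hb := not_dvd_im_sqrt φ hs hd hdsq hpp (by rintro rfl; omega)
  have h2a := two_mul_re_sqrt φ hs hd
  have h1 := im_sqrt_sq_mul_norm φ hs hd x
  have hN := norm_eq_or_eq_neg_of_associated_sq φ hx
  set a := (φ s).re
  set b := (φ s).im
  set X := b * (φ x).re - a * (φ x).im with hX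
  have hpN : (p : ℤ) ∣ (φ x).norm := by rcases hN with h | h <;> simp [h]
  have hpy : ¬ (p : ℤ) ∣ (φ x).im := by
    intro hy
    rw [QuadraticAlgebra.norm_def] at hN hpN
    have hpx : (p : ℤ) ∣ (φ x).re := by
      have h3 : (p : ℤ) ∣ (φ x).re * (φ x).re := by
        have h4 : (φ x).re * (φ x).re = ((φ x).re * (φ x).re + t * (φ x).re * (φ x).im -
          n * (φ x).im * (φ x).im) - (φ x).im * (t * (φ x).re - n * (φ x).im) := by ring
        rw [h4]
        exact dvd_sub hpN (hy.mul_right _)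
      exact (hpi.dvd_or_dvd h3).elim id id
    have h5 : (p : ℤ) * p ∣ (p : ℤ) * 1 := by
      have h6 : (p : ℤ) * p ∣ (φ x).re * (φ x).re + t * (φ x).re * (φ x).im -
          n * (φ x).im * (φ x).im := by
        rw [mul_assoc, mul_assoc]
        exact dvd_sub (dvd_add (mul_dvd_mul hpx hpx) ((mul_dvd_mul hpx hy).mul_left _))
          ((mul_dvd_mul hy hy).mul_left _)
      rcases hN with h | h <;> rw [h] at h6
      · simpa using h6
      · simpa using h6
    rw [mul_dvd_mul_iff_left hpi.ne_zero] at h5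
    exact hpi.not_isUnit (isUnit_of_dvd_one h5)
  have hpX : (p : ℤ) ∣ X := by
    -- This product is the second coordinate of `x²`, an associate of `p`.
    have h3 : (p : ℤ) ∣ (φ x).im * (2 * (φ x).re + t * (φ x).im) := by
      have h4 := ((natCast_dvd_iff_coords φ p _).1 hx.dvd).2
      rw [sq, map_mul, QuadraticAlgebra.im_mul] at h4
      convert! h4 using 1
      ring
    have h5 := (hpi.dvd_or_dvd h3).resolve_left hpy
    have h6 : (p : ℤ) ∣ 2 * X := by
      have : 2 * X = b * (2 * (φ x).re + t * (φ x).im) := by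
        rw [hX]
        linear_combination -(φ x).im * h2a
      rw [this]
      exact h5.mul_left _
    refine (hpi.dvd_or_dvd h6).resolve_left fun h7 => ?_
    have := (Nat.prime_dvd_prime_iff_eq hpp Nat.prime_two).1 (by exact_mod_cast h7)
    omega
  have hpd : p ∣ d := by
    have h3 : (p : ℤ) ∣ d * (φ x).im ^ 2 := by
      have : d * (φ x).im ^ 2 = X ^ 2 - b ^ 2 * (φ x).norm := by rw [h1]; ring
      rw [this]
      exact dvd_sub (dvd_pow hpX two_ne_zero) (hpN.mul_left _)
    exact_mod_cast (hpi.dvd_or_dvd h3).resolve_right fun h => hpy (hpi.dvd_of_dvd_pow h)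
  obtain ⟨e, rfl⟩ := hpd
  obtain ⟨c, hc⟩ := hpX
  rw [Nat.mul_div_cancel_left _ hpp.pos]
  rw [← ZMod.intCast_zmod_eq_zero_iff_dvd] at hpy
  rw [hc] at h1
  rcases hN with h | h <;> rw [h] at h1
  · have h3 : b ^ 2 = p * c ^ 2 - e * (φ x).im ^ 2 := by
      apply mul_left_cancel₀ hpi.ne_zero
      push_cast at h1
      linear_combination h1
    have h4 := congrArg (Int.cast : ℤ → ZMod p) h3
    push_cast at h4
    rw [ZMod.natCast_self, zero_mul, zero_sub] at h4
    refine ZMod.isSquare_neg_of_isSquare hp ⟨b / (φ x).im, ?_⟩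
    field_simp
    linear_combination -h4
  · have h3 : b ^ 2 = e * (φ x).im ^ 2 - p * c ^ 2 := by
      apply mul_left_cancel₀ hpi.ne_zero
      push_cast at h1
      linear_combination -h1
    have h4 := congrArg (Int.cast : ℤ → ZMod p) h3
    push_cast at h4
    rw [ZMod.natCast_self, zero_mul, sub_zero] at h4
    refine ⟨b / (φ x).im, ?_⟩
    field_simp
    linear_combination -h4

/-- An element coprime to `f` has a unit multiple congruent to a rational integer modulo `q`, so its
norm is `±` a square, hence a square, modulo `q`. If `q ∤ d`, some `x + s` has nonsquare norm `x² -
d`, a contradiction. -/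
theorem dvd_of_prime_dvd_of_forall_exists_unit (hs : s ^ 2 = (d : R)) (hd : ¬ IsSquare d)
    {f : ℕ} (hf : Squarefree f) {O : Subring R} (hO : ∀ x, x ∈ O ↔ (f : ℤ) ∣ (φ x).im)
    (hu : ∀ x : R, IsCoprime x (f : R) → ∃ u : Rˣ, u * x ∈ O) {q : ℕ} [Fact q.Prime]
    (hq : q % 4 = 1) (hqf : q ∣ f) : q ∣ d := by
  have hqp : q.Prime := Fact.out
  by_contra hqd
  rw [← ZMod.natCast_eq_zero_iff] at hqd
  obtain ⟨x₀, hx₀⟩ := ZMod.exists_not_isSquare_sq_sub hq hqd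
  obtain ⟨x, rfl⟩ := ZMod.intCast_surjective x₀
  have hN := norm_intCast_add_sqrt φ hs hd x
  have hcop : IsCoprime ((x : R) + s) (q : R) := by
    have h1 : IsCoprime (x ^ 2 - d : ℤ) (q : ℤ) := by
      refine ((Nat.prime_iff_prime_int.1 hqp).coprime_iff_not_dvd.2 fun h => hx₀ ?_).symm
      rw [← ZMod.intCast_zmod_eq_zero_iff_dvd] at h
      push_cast at h
      rw [h]
      exact IsSquare.zero
    have h2 := h1.map (Int.castRingHom R)
    refine IsCoprime.of_isCoprime_of_dvd_left (by simpa using h2) ?_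
    refine ⟨φ.symm (star (φ (x + s))), ?_⟩
    apply φ.injective
    rw [map_mul, RingEquiv.apply_symm_apply, ← QuadraticAlgebra.algebraMap_norm_eq_mul_star, hN]
    simp
  -- Prescribing `1` at the other primes makes `z` coprime to all of `f`.
  obtain ⟨z, hz⟩ := exists_forall_prime_dvd_sub (R := R) hf.ne_zero
    fun p => if p = q then (x : R) + s else 1
  have hzc : IsCoprime z (f : R) := by
    refine isCoprime_natCast_of_forall_prime hf fun p hp hpf => ?_
    obtain ⟨c, hc⟩ := hz p hp hpf
    rw [sub_eq_iff_eq_add'] at hc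
    rw [hc]
    refine IsCoprime.add_mul_left_left_iff.2 ?_
    split_ifs with h
    · exact h ▸ hcop
    · exact isCoprime_one_left
  obtain ⟨u, huz⟩ := hu z hzc
  obtain ⟨a, w, haw⟩ := exists_eq_intCast_add_of_dvd_im φ q _
    ((Int.natCast_dvd_natCast.2 hqf).trans ((hO _).1 huz))
  have h1 := dvd_norm_sub_norm φ (hz q hqp hqf)
  rw [if_pos rfl, hN] at h1
  have h2 : (q : ℤ) ∣ (φ (u * z)).norm - (φ (a : R)).norm :=
    dvd_norm_sub_norm φ ⟨w, by rw [haw]; ring⟩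
  rw [map_intCast, QuadraticAlgebra.norm_intCast, map_mul, map_mul] at h2
  rw [← ZMod.intCast_zmod_eq_zero_iff_dvd] at h1 h2
  push_cast at h1 h2 hx₀
  rcases norm_units_eq_one_or_neg_one φ u with h3 | h3
  · rw [h3] at h2
    push_cast at h2
    exact hx₀ ⟨a, by linear_combination h2 - h1⟩
  · rw [h3] at h2
    push_cast at h2
    exact hx₀ (ZMod.isSquare_neg_of_isSquare hq ⟨a, by linear_combination h2 + h1⟩)

include φ in
theorem not_isPrincipal_of_span_eq_sq (hs : s ^ 2 = (d : R)) (hd : ¬ IsSquare d)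
    (hdsq : Squarefree d) [IsDomain R]
    {f : ℕ} (hf : Squarefree f) {O : Subring R} (hO : ∀ x, x ∈ O ↔ (f : ℤ) ∣ (φ x).im)
    (hu : ∀ x : R, IsCoprime x (f : R) → ∃ u : Rˣ, u * x ∈ O) {p : ℕ} (hp : p.Prime)
    (h : (p % 4 = 1 ∧ jacobiSym ((d / p : ℕ) : ℤ) p = -1) ∨
      (∃ q : ℕ, q.Prime ∧ q % 4 = 1 ∧ q ∣ d * f ∧ jacobiSym (p : ℤ) q = -1))
    {P : Ideal R} (hP : Ideal.span {(p : R)} = P ^ 2) : ¬ P.IsPrincipal := by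
  rintro ⟨⟨x, hx⟩⟩
  rw [hx, Ideal.submodule_span_eq, Ideal.span_singleton_pow,
    Ideal.span_singleton_eq_span_singleton] at hP
  rcases h with ⟨hp4, hj⟩ | ⟨q, hq, hq4, hqdf, hj⟩
  · have := Fact.mk hp
    rw [← jacobiSym.legendreSym.to_jacobiSym, legendreSym.eq_neg_one_iff] at hj
    apply hj
    exact_mod_cast isSquare_natCast_div_of_associated_sq φ hs hd hdsq hp4 hP
  · have := Fact.mk hq
    rw [← jacobiSym.legendreSym.to_jacobiSym, legendreSym.eq_neg_one_iff] at hj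
    apply hj
    have hqd : q ∣ d := (hq.dvd_mul.1 hqdf).elim id
      (dvd_of_prime_dvd_of_forall_exists_unit φ hs hd hf hO hu hq4)
    exact_mod_cast isSquare_natCast_of_norm_eq φ hs hd hdsq hq4 hqd
      (norm_eq_or_eq_neg_of_associated_sq φ hP)

end NormObstruction

/-! ### Minimal balanced multisets and their weights modulo 4 -/

section Weights

open Classical in
/-- A multiset is balanced if evenly many of its elements satisfy `N`, and no element satisfying
`S` occurs exactly once. -/
def Multiset.Balanced {ι : Type*} (N S : ι → Prop) (M : Multiset ι) : Prop :=
  Even (M.countP N) ∧ ∀ x, S x → M.count x ≠ 1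

open Classical in
/-- The weight of a prime modulo `4`; it sums to `2` over every minimal balanced multiset. -/
noncomputable def primeWeight {ι : Type*} (N S : ι → Prop) (x : ι) : ZMod 4 :=
  if S x then 3 else if N x then 1 else 2

/-- With `x, x'` special, `y, y'` in `N` but not special, and `z` outside `N`, the possible minimal
multisets are `z`, `x²`, `x³x'³`, `x³y` and `yy'`. Their weights 2, 6, 18, 10, 2 all agree modulo 4.
-/
theorem Multiset.sum_map_primeWeight_eq_two {ι : Type*} {N S : ι → Prop} (hSN : ∀ x, S x → N x)
    {M : Multiset ι} (hM : M.Balanced N S) (hM0 : M ≠ 0)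
    (hmin : ∀ A B : Multiset ι, M = A + B → A.Balanced N S → B.Balanced N S → A = 0 ∨ B = 0) :
    (M.map (primeWeight N S)).sum = 2 := by
  classical
  obtain ⟨hMe, hMS⟩ := hM
  -- a balanced `A ≤ M`, nonzero, whose multiplicities at special primes are not off by one from
  -- those of `M`, exhausts `M`
  have hsub : ∀ A : Multiset ι, A ≤ M → A ≠ 0 → A.Balanced N S →
      (∀ x, S x → M.count x ≠ A.count x + 1) → M = A := by
    intro A hA hA0 hAb hAx
    obtain ⟨B, rfl⟩ := Multiset.le_iff_exists_add.1 hA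
    have hB : B.Balanced N S := by
      refine ⟨?_, fun x hx h => hAx x hx (by rw [Multiset.count_add, h])⟩
      have := hAb.1
      rw [Multiset.countP_add, Nat.even_add] at hMe
      simp only [Multiset.Balanced] at hAb
      convert! hMe.1 (by convert! hAb.1)
    have := (hmin A B rfl hAb hB).resolve_left hA0
    rw [this, add_zero]
  by_cases h1 : ∃ x ∈ M, ¬ N x
  · obtain ⟨x, hx, hNx⟩ := h1
    have hSx : ¬ S x := fun h => hNx (hSN x h)
    have : M = {x} := by
      refine hsub {x} (by simpa using hx) (by simp) ⟨?_, ?_⟩ ?_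
      · rw [← Multiset.cons_zero, Multiset.countP_cons_of_neg _ hNx]
        simp
      · intro y hy
        have : y ≠ x := by rintro rfl; exact hSx hy
        simp [this]
      · intro y hy
        have : y ≠ x := by rintro rfl; exact hSx hy
        simpa [this] using hMS y hy
    simp [this, primeWeight, hSx, hNx]
  push Not at h1
  rw [Multiset.countP_eq_card.2 h1] at hMe
  have hsub' : ∀ A : Multiset ι, A ≤ M → A ≠ 0 → Even (Multiset.card A) →
      (∀ x, S x → A.count x ≠ 1 ∧ M.count x ≠ A.count x + 1) → M = A := by
    intro A hA hA0 hAe hAS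
    refine hsub A hA hA0 ⟨?_, fun x hx => (hAS x hx).1⟩ fun x hx => (hAS x hx).2
    rwa [Multiset.countP_eq_card.2 fun x hx => h1 x (Multiset.mem_of_le hA hx)]
  by_cases h2 : ∃ x, S x ∧ (M.count x = 2 ∨ 4 ≤ M.count x)
  -- Two copies of `x` can be split off, since the remaining multiplicity is not 1. Past this case,
  -- every special element of `M` occurs exactly three times.
  · obtain ⟨x, hx, hc⟩ := h2
    have : M = Multiset.replicate 2 x := by
      refine hsub' _ (Multiset.le_count_iff_replicate_le.1 (by omega)) (by simp) (by simp) ?_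
      intro y hy
      have := hMS y hy
      rw [Multiset.count_replicate]
      split_ifs with h
      · subst h
        omega
      · omega
    simp only [this, Multiset.map_replicate, primeWeight, hx, if_true, Multiset.sum_replicate]
    decide
  push Not at h2
  by_cases h3 : ∃ x y, S x ∧ S y ∧ x ≠ y ∧ x ∈ M ∧ y ∈ M
  · obtain ⟨x, y, hx, hy, hxy, hxM, hyM⟩ := h3
    have hx3 : M.count x = 3 := by
      have := Multiset.one_le_count_iff_mem.2 hxM
      have := hMS x hx
      have := h2 x hx
      omega
    have hy3 : M.count y = 3 := by
      have := Multiset.one_le_count_iff_mem.2 hyM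
      have := hMS y hy
      have := h2 y hy
      omega
    have : M = Multiset.replicate 3 x + Multiset.replicate 3 y := by
      refine hsub' _ ?_ (by simp) (by simp; decide) ?_
      · rw [Multiset.le_iff_count]
        intro z
        rw [Multiset.count_add, Multiset.count_replicate, Multiset.count_replicate]
        split_ifs with h h' h'
        · exact absurd (h.trans h'.symm) hxy
        · subst h
          omega
        · subst h'
          omega
        · omega
      · intro z hz
        have := hMS z hz
        rw [Multiset.count_add, Multiset.count_replicate, Multiset.count_replicate]
        split_ifs with h h' h'
        · exact absurd (h.trans h'.symm) hxy
        · subst h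
          omega
        · subst h'
          omega
        · omega
    simp only [this, Multiset.map_add, Multiset.sum_add, Multiset.map_replicate, primeWeight, hx,
      hy, if_true, Multiset.sum_replicate]
    decide
  push Not at h3
  have hsum : M = M.filter S + M.filter fun x => ¬ S x := (Multiset.filter_add_not S M).symm
  by_cases h4 : 2 ≤ Multiset.card (M.filter fun x => ¬ S x)
  · have hpos : 0 < Multiset.card (Multiset.powersetCard 2 (M.filter fun x => ¬ S x)) := by
      rw [Multiset.card_powersetCard]
      exact Nat.choose_pos h4
    obtain ⟨A, hA⟩ := Multiset.card_pos_iff_exists_mem.1 hpos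
    obtain ⟨hA, hAc⟩ := Multiset.mem_powersetCard.1 hA
    obtain ⟨x, y, rfl⟩ := Multiset.card_eq_two.1 hAc
    have hAS : ∀ z ∈ ({x, y} : Multiset ι), ¬ S z := fun z hz =>
      (Multiset.mem_filter.1 (Multiset.mem_of_le hA hz)).2
    have hAM : ({x, y} : Multiset ι) ≤ M := hA.trans (Multiset.filter_le _ _)
    have hMxy : M = {x, y} := by
      refine hsub' _ hAM (by simp) (by simp) ?_
      intro z hz
      have h5 : Multiset.count z {x, y} = 0 := Multiset.count_eq_zero.2 fun h => hAS z h hz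
      rw [h5]
      exact ⟨by omega, hMS z hz⟩
    have hx : ¬ S x := hAS x (by simp)
    have hy : ¬ S y := hAS y (by simp)
    have hNx : N x := h1 x (by rw [hMxy]; simp)
    have hNy : N y := h1 y (by rw [hMxy]; simp)
    rw [hMxy]
    simp only [Multiset.insert_eq_cons, Multiset.map_cons, Multiset.map_singleton,
      Multiset.sum_cons, Multiset.sum_singleton, primeWeight, hx, hy, hNx, hNy, if_true, if_false]
    decide
  -- At most one special element, of multiplicity three, and at most one nonspecial element remain.
  -- Even cardinality leaves only `x³y`.
  rcases Multiset.empty_or_exists_mem (M.filter S) with h5 | ⟨x, hx⟩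
  · exfalso
    rw [h5, zero_add] at hsum
    rw [← hsum] at h4
    have := Multiset.card_pos.2 hM0
    have h6 : Multiset.card M = 1 := by omega
    rw [h6] at hMe
    exact absurd hMe (by decide)
  · obtain ⟨hxM, hxS⟩ := Multiset.mem_filter.1 hx
    have hx3 : M.count x = 3 := by
      have := Multiset.one_le_count_iff_mem.2 hxM
      have := hMS x hxS
      have := h2 x hxS
      omega
    have h6 : M.filter S = Multiset.replicate 3 x := by
      have h7 : ∀ y ∈ M.filter S, y = x := by
        intro y hy
        obtain ⟨hyM, hyS⟩ := Multiset.mem_filter.1 hy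
        by_contra hne
        exact h3 y x hyS hxS hne hyM hxM
      have h8 := Multiset.eq_replicate_card.2 h7
      have h9 := Multiset.count_filter_of_pos (s := M) hxS
      rw [h8, Multiset.count_replicate_self, hx3] at h9
      rw [h8, h9]
    rw [h6] at hsum
    have h7 : Multiset.card (M.filter fun x => ¬ S x) = 1 := by
      have h8 := congrArg Multiset.card hsum
      rw [Multiset.card_add, Multiset.card_replicate] at h8
      rw [h8, Nat.even_iff] at hMe
      omega
    obtain ⟨y, hy⟩ := Multiset.card_eq_one.1 h7
    obtain ⟨hyM, hyS⟩ := Multiset.mem_filter.1 (show y ∈ M.filter fun x => ¬ S x by simp [hy])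
    have hNy := h1 y hyM
    rw [hy] at hsum
    rw [hsum]
    simp only [Multiset.map_add, Multiset.sum_add, Multiset.map_replicate, Multiset.map_singleton,
      Multiset.sum_replicate, Multiset.sum_singleton, primeWeight, hxS, hyS, hNy, if_true, if_false]
    decide

end Weights

/-! ### Lengths in a monoid that transfers to balanced multisets -/

section TransferMonoid

open QuadOrder

variable {ι : Type*} {N S : ι → Prop} {H : Type*} [CommMonoid H]

theorem Associates.irreducible_mk_iff {a : H} : Irreducible (Associates.mk a) ↔ Irreducible a := by
  constructor
  · intro h
    refine ⟨fun hu => h.not_isUnit (Associates.isUnit_mk.2 hu), fun b c hbc => ?_⟩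
    have := h.isUnit_or_isUnit (a := Associates.mk b) (b := Associates.mk c)
      (by rw [Associates.mk_mul_mk, hbc])
    rwa [Associates.isUnit_mk, Associates.isUnit_mk] at this
  · intro h
    refine ⟨fun hu => h.not_isUnit (Associates.isUnit_mk.1 hu), fun x y hxy => ?_⟩
    obtain ⟨b, rfl⟩ := Associates.mk_surjective x
    obtain ⟨c, rfl⟩ := Associates.mk_surjective y
    rw [Associates.mk_mul_mk, Associates.mk_eq_mk_iff_associated] at hxy
    rw [Associates.isUnit_mk, Associates.isUnit_mk]
    exact (hxy.irreducible h).isUnit_or_isUnit rfl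

theorem QuadOrder.card_mem_lengths {a : H} {s : Multiset H} (hs : ∀ b ∈ s, Irreducible b)
    (ha : s.prod = a) : Multiset.card s ∈ lengths H a := by
  refine ⟨s.map Associates.mk, ⟨?_, ?_⟩, Multiset.card_map _ _⟩
  · intro u hu
    obtain ⟨b, hb, rfl⟩ := Multiset.mem_map.1 hu
    exact Associates.irreducible_mk_iff.2 (hs b hb)
  · rw [Associates.prod_mk, ha]

open Classical in
theorem Multiset.balanced_of_forall_mem {A : Multiset ι} (hN : ∀ z ∈ A, N z)
    (hA : Even (Multiset.card A)) (hS : ∀ z, S z → A.count z ≠ 1) : A.Balanced N S :=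
  ⟨by rwa [Multiset.countP_eq_card.2 hN], hS⟩

/-- A homomorphism from a monoid onto balanced multisets which reflects units and along which
decompositions into balanced multisets lift. -/
structure BalancedTransfer (N S : ι → Prop) (F : H → Multiset ι) : Prop where
  map_mul : ∀ a b, F (a * b) = F a + F b
  map_eq_zero : ∀ a, F a = 0 ↔ IsUnit a
  balanced : ∀ a, (F a).Balanced N S
  split : ∀ a A B, F a = A + B → A.Balanced N S → B.Balanced N S →
    ∃ b c, a = b * c ∧ F b = A ∧ F c = B

namespace BalancedTransfer

variable {F : H → Multiset ι} (hF : BalancedTransfer N S F)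

include hF

theorem map_one : F 1 = 0 := (hF.map_eq_zero 1).2 isUnit_one

theorem eq_of_associated {a b : H} (h : Associated a b) : F a = F b := by
  obtain ⟨u, rfl⟩ := h
  rw [hF.map_mul, (hF.map_eq_zero u).2 u.isUnit, add_zero]

theorem irreducible_of_forall {a : H} (h0 : F a ≠ 0)
    (h : ∀ A B, F a = A + B → A.Balanced N S → B.Balanced N S → A = 0 ∨ B = 0) :
    Irreducible a := by
  refine ⟨fun hu => h0 ((hF.map_eq_zero a).2 hu), fun b c hbc => ?_⟩
  have := h (F b) (F c) (by rw [hbc, hF.map_mul]) (hF.balanced b) (hF.balanced c)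
  rwa [hF.map_eq_zero, hF.map_eq_zero] at this

theorem sum_weight_of_irreducible (hSN : ∀ x, S x → N x) {a : H} (ha : Irreducible a) :
    ((F a).map (primeWeight N S)).sum = 2 := by
  refine Multiset.sum_map_primeWeight_eq_two hSN (hF.balanced a) ?_ ?_
  · rw [ne_eq, hF.map_eq_zero]
    exact ha.not_isUnit
  · intro A B hAB hA hB
    obtain ⟨b, c, rfl, rfl, rfl⟩ := hF.split a A B hAB hA hB
    rw [hF.map_eq_zero, hF.map_eq_zero]
    exact ha.isUnit_or_isUnit rfl

/-- The weight is additive and every atom contributes 2 modulo 4, so `F a` determines the parity of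
every length of `a`. -/
theorem sum_weight_of_mem_lengths (hSN : ∀ x, S x → N x) {a : H} {k : ℕ}
    (hk : k ∈ lengths H a) : ((F a).map (primeWeight N S)).sum = 2 * k := by
  obtain ⟨z, ⟨hz, hza⟩, rfl⟩ := hk
  obtain ⟨s, rfl⟩ := Multiset.map_surjective_of_surjective Associates.mk_surjective z
  rw [Associates.prod_mk, Associates.mk_eq_mk_iff_associated] at hza
  rw [← hF.eq_of_associated hza, Multiset.card_map]
  clear hza
  induction s using Multiset.induction_on with
  | empty => simp [hF.map_one]
  | cons b s ih =>
    have hb : Irreducible b :=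
      Associates.irreducible_mk_iff.1 (hz _ (Multiset.mem_map_of_mem _ (Multiset.mem_cons_self b s)))
    rw [Multiset.prod_cons, hF.map_mul, Multiset.map_add, Multiset.sum_add,
      hF.sum_weight_of_irreducible hSN hb,
      ih fun u hu => hz u (Multiset.mem_of_le (Multiset.map_le_map (Multiset.le_cons_self s b)) hu),
      Multiset.card_cons]
    push_cast
    ring

theorem irreducible_of_eq_replicate_two {a : H} {x : ι} (hx : S x ∨ N x)
    (ha : F a = Multiset.replicate 2 x) : Irreducible a := by
  classical
  have hmem : ∀ A : Multiset ι, A ≤ Multiset.replicate 2 x → A.Balanced N S →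
      ∃ i, A = Multiset.replicate i x ∧ i ≠ 1 := by
    intro A hA hAb
    obtain ⟨i, -, rfl⟩ := Multiset.le_replicate_iff.1 hA
    refine ⟨i, rfl, ?_⟩
    rintro rfl
    rcases hx with hx | hx
    · exact hAb.2 x hx (by convert! Multiset.count_replicate_self x 1)
    · have h1 := hAb.1
      rw [Multiset.countP_eq_card.2 (by simpa using hx), Multiset.card_replicate] at h1
      exact absurd h1 (by decide)
  refine hF.irreducible_of_forall (by rw [ha]; simp) fun A B hAB hA hB => ?_
  rw [ha] at hAB
  obtain ⟨i, rfl, hi⟩ := hmem A (hAB ▸ Multiset.le_add_right A B) hA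
  obtain ⟨j, rfl, hj⟩ := hmem B (hAB ▸ Multiset.le_add_left B _) hB
  have := congrArg Multiset.card hAB
  simp only [Multiset.card_replicate, Multiset.card_add] at this
  have : i = 0 ∨ j = 0 := by omega
  rcases this with rfl | rfl <;> simp

theorem irreducible_of_eq_replicate_three_add {a : H} {x y : ι} (hx : S x) (hy : N y)
    (hyS : ¬ S y) (ha : F a = Multiset.replicate 3 x + {y}) : Irreducible a := by
  classical
  have hxy : x ≠ y := by
    rintro rfl
    exact hyS hx
  have hzero : ∀ A : Multiset ι, A ≤ Multiset.replicate 3 x + {y} → A.Balanced N S →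
      A.count x = 0 → A = 0 := by
    intro A hA hAb hAx
    have h1 : A ≤ {y} := by
      rw [Multiset.le_iff_count]
      intro z
      by_cases hz : z = x
      · subst hz
        omega
      · have := Multiset.le_iff_count.1 hA z
        rwa [Multiset.count_add, Multiset.count_replicate, if_neg (Ne.symm hz), zero_add] at this
    rcases Multiset.le_singleton.1 h1 with rfl | rfl
    · rfl
    · have h2 := hAb.1
      rw [Multiset.countP_eq_card.2 (by simpa using hy), Multiset.card_singleton] at h2
      exact absurd h2 (by decide)
  refine hF.irreducible_of_forall (by rw [ha]; simp) fun A B hAB hA hB => ?_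
  rw [ha] at hAB
  have h3 := congrArg (Multiset.count x) hAB
  rw [Multiset.count_add, Multiset.count_add, Multiset.count_replicate_self,
    Multiset.count_singleton, if_neg hxy] at h3
  have hA1 : A.count x ≠ 1 := by convert! hA.2 x hx
  have hB1 : B.count x ≠ 1 := by convert! hB.2 x hx
  have : A.count x = 0 ∨ B.count x = 0 := by omega
  exact this.imp (hzero A (hAB ▸ Multiset.le_add_right A B) hA)
    (hzero B (hAB ▸ Multiset.le_add_left B A) hB)

theorem isLeast_monoidDistances (hSN : ∀ x, S x → N x) {a : H} {x y : ι} (hx : S x) (hy : N y)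
    (hyS : ¬ S y) (ha : F a = Multiset.replicate 3 x + {y}) :
    IsLeast (monoidDistances H) 2 := by
  classical
  have hparity : ∀ (b : H) (k : ℕ), k ∈ lengths H b → k + 1 ∉ lengths H b := by
    intro b k hk hk1
    have h1 := hF.sum_weight_of_mem_lengths hSN hk
    rw [hF.sum_weight_of_mem_lengths hSN hk1] at h1
    push_cast at h1
    have h2 : (2 : ZMod 4) = 0 := by linear_combination h1
    exact absurd h2 (by decide)
  have hxy : x ≠ y := by
    rintro rfl
    exact hyS hx
  have hNx := hSN x hx
  set X := Multiset.replicate 2 x with hX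
  set Y := Multiset.replicate 2 y with hY
  have hcount : ∀ z, X.count z = 0 ∧ Y.count z ≠ 1 ∨ X.count z = 2 ∧ Y.count z = 0 := by
    intro z
    rw [hX, hY, Multiset.count_replicate, Multiset.count_replicate]
    by_cases hz : x = z
    · subst hz
      simp [hxy.symm]
    · left
      rw [if_neg hz]
      refine ⟨rfl, ?_⟩
      split_ifs <;> omega
  have hXb : X.Balanced N S := by
    refine Multiset.balanced_of_forall_mem (by simp [hX, hNx]) (by simp [hX]) fun z _ => ?_
    have := hcount z
    omega
  have hYb : Y.Balanced N S := by
    refine Multiset.balanced_of_forall_mem (by simp [hY, hy]) (by simp [hY]) fun z _ => ?_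
    have := hcount z
    omega
  have hXYb : (X + Y).Balanced N S := by
    refine Multiset.balanced_of_forall_mem (by simp [hX, hY, hNx, hy]) (by simp [hX, hY]; decide)
      fun z _ => ?_
    have := hcount z
    rw [Multiset.count_add]
    omega
  have hXXYb : (X + (X + Y)).Balanced N S := by
    refine Multiset.balanced_of_forall_mem (by simp [hX, hY, hNx, hy]) (by simp [hX, hY]; decide)
      fun z _ => ?_
    have := hcount z
    rw [Multiset.count_add, Multiset.count_add]
    omega
  -- The regrouping `(x³y)² = x²·x²·x²·y²` yields the lengths 2 and 4; parity excludes 3.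
  have haa : F (a * a) = X + (X + (X + Y)) := by
    rw [hF.map_mul, ha, hX, hY]
    ext z
    simp only [Multiset.count_add, Multiset.count_replicate, Multiset.count_singleton]
    grind
  obtain ⟨b₁, c₁, h₁, hb₁, hc₁⟩ := hF.split _ _ _ haa hXb hXXYb
  obtain ⟨b₂, c₂, rfl, hb₂, hc₂⟩ := hF.split _ _ _ hc₁ hXb hXYb
  obtain ⟨b₃, b₄, rfl, hb₃, hb₄⟩ := hF.split _ _ _ hc₂ hXb hYb
  have ha' := hF.irreducible_of_eq_replicate_three_add hx hy hyS ha
  have hb₁' := hF.irreducible_of_eq_replicate_two (Or.inl hx) hb₁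
  have hb₂' := hF.irreducible_of_eq_replicate_two (Or.inl hx) hb₂
  have hb₃' := hF.irreducible_of_eq_replicate_two (Or.inl hx) hb₃
  have hb₄' := hF.irreducible_of_eq_replicate_two (Or.inr hy) hb₄
  have hL2 : 2 ∈ lengths H (a * a) :=
    card_mem_lengths (s := {a, a}) (by simp [ha']) (by simp)
  have hL4 : 4 ∈ lengths H (a * a) :=
    card_mem_lengths (s := {b₁, b₂, b₃, b₄}) (by simp [hb₁', hb₂', hb₃', hb₄']) (by simp [h₁])
  constructor
  · refine Set.mem_iUnion.2 ⟨a * a, by norm_num, 2, hL2, ?_⟩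
    ext k
    simp only [Set.mem_inter_iff, Set.mem_Icc, Set.mem_insert_iff, Set.mem_singleton_iff]
    constructor
    · rintro ⟨hk, h1, h2⟩
      have : k ≠ 3 := by
        rintro rfl
        exact hparity _ 2 hL2 hk
      omega
    · rintro (rfl | rfl)
      · exact ⟨hL2, by norm_num, by norm_num⟩
      · exact ⟨hL4, by norm_num, by norm_num⟩
  · intro δ hδ
    obtain ⟨b, hδ0, k, hk, hkδ⟩ := Set.mem_iUnion.1 hδ
    by_contra hlt
    have hδ1 : δ = 1 := by omega
    subst hδ1
    have : k + 1 ∈ lengths H b ∩ Set.Icc k (k + 1) := by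
      rw [hkδ]
      simp
    exact hparity b k hk this.1

end BalancedTransfer

end TransferMonoid

/-! ### Prime ideal factorizations of elements of the order -/

section IdealFactorization

open UniqueFactorizationMonoid QuadOrder

/-- The prime ideals whose square is generated by a rational prime divisor of `f`. -/
def IsRamifiedPrimeOver {R : Type*} [CommRing R] (f : ℕ) (P : Ideal R) : Prop :=
  P.IsPrime ∧ ∃ p : ℕ, p.Prime ∧ p ∣ f ∧ Ideal.span {(p : R)} = P ^ 2

variable {R : Type*} [CommRing R] [IsDedekindDomain R]

open Classical in
theorem Ideal.pow_dvd_iff_le_count_normalizedFactors {P I : Ideal R} (hP : Prime P) (hI : I ≠ 0)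
    (k : ℕ) : P ^ k ∣ I ↔ k ≤ (normalizedFactors I).count P := by
  rw [dvd_iff_normalizedFactors_le_normalizedFactors (pow_ne_zero k hP.ne_zero) hI,
    hP.irreducible.normalizedFactors_pow, normalize_eq, Multiset.le_count_iff_replicate_le]

open Classical in
theorem Ideal.isPrincipal_prod_iff_even_countP (h : Nat.card (CommRing.Pic R) = 2)
    (M : Multiset (Ideal R)) (hM : ∀ Q ∈ M, Prime Q) :
    M.prod.IsPrincipal ↔ Even (M.countP fun Q => ¬ Q.IsPrincipal) := by
  induction M using Multiset.induction_on with
  | empty =>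
    simp only [Multiset.prod_zero, Multiset.countP_zero, Even.zero, iff_true]
    exact ⟨⟨1, by simp⟩⟩
  | cons Q M ih =>
    have hM' : ∀ Q ∈ M, Prime Q := fun Q' hQ' => hM Q' (Multiset.mem_cons_of_mem hQ')
    have hprod : M.prod ≠ 0 := Multiset.prod_ne_zero fun h0 => (hM' 0 h0).ne_zero rfl
    rw [Multiset.prod_cons, Ideal.isPrincipal_mul_iff_of_card_pic_eq_two h
      (hM Q (Multiset.mem_cons_self Q M)).ne_zero hprod, ih hM', Multiset.countP_cons]
    by_cases hQ : Q.IsPrincipal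
    · simp [hQ]
    · simp [hQ, Nat.even_add_one]

variable {n t : ℤ} (φ : R ≃+* QuadraticAlgebra ℤ n t) {f : ℕ}

omit [IsDedekindDomain R] in
include φ in
theorem natCast_ne_zero_of_coords {m : ℕ} (hm : m ≠ 0) : (m : R) ≠ 0 := by
  intro h
  have := congrArg (fun z => (φ z).re) h
  simp only [map_natCast, QuadraticAlgebra.re_natCast, map_zero, QuadraticAlgebra.re_zero] at this
  exact hm (by exact_mod_cast this)

include φ in
theorem IsRamifiedPrimeOver.prime {P : Ideal R} (hP : IsRamifiedPrimeOver f P) : Prime P := by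
  obtain ⟨hP, p, hp, -, hpP⟩ := hP
  refine Ideal.prime_of_isPrime ?_ hP
  rintro rfl
  rw [Ideal.bot_pow two_ne_zero, Ideal.span_singleton_eq_bot] at hpP
  exact natCast_ne_zero_of_coords φ hp.ne_zero hpP

theorem Ideal.not_dvd_of_isCoprime_of_dvd {P : Ideal R} (hP : P.IsPrime) {x y : R}
    (h : IsCoprime x y) (hy : P ∣ Ideal.span {y}) : ¬ P ∣ Ideal.span {x} := by
  rw [Ideal.dvd_span_singleton] at hy ⊢
  intro hx
  obtain ⟨a, b, hab⟩ := h
  apply hP.ne_top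
  rw [Ideal.eq_top_iff_one, ← hab]
  exact P.add_mem (P.mul_mem_left _ hx) (P.mul_mem_left _ hy)

open Classical in
include φ in
-- At an inert `p` the ideal `pR` is itself maximal, so there is no condition. At `pR = P²`,
-- multiplicity 0 of `P` means coprime to `p`, and at least 2 means divisible by `p`.
theorem admissibleAt_iff_count_ne_one
    (hpf : ∀ p : ℕ, p.Prime → p ∣ f → (Ideal.span {(p : R)}).IsPrime ∨
      ∃ P : Ideal R, P.IsPrime ∧ Ideal.span {(p : R)} = P ^ 2) {x : R} (hx : x ≠ 0) :
    AdmissibleAt f x ↔ ∀ P : Ideal R, IsRamifiedPrimeOver f P →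
      (normalizedFactors (Ideal.span {x})).count P ≠ 1 := by
  have hx' : Ideal.span {x} ≠ 0 := by simpa using hx
  constructor
  · intro h P hP hc
    have hcount := Ideal.pow_dvd_iff_le_count_normalizedFactors (hP.prime φ) hx'
    obtain ⟨hPp, p, hp, hpf', hpP⟩ := hP
    rcases h p hp hpf' with h1 | h1
    · refine Ideal.not_dvd_of_isCoprime_of_dvd hPp h1 (hpP ▸ dvd_pow_self P two_ne_zero) ?_
      rw [← pow_one P, hcount, hc]
    · have h2 : P ^ 2 ∣ Ideal.span {x} := by
        rw [← hpP, Ideal.dvd_span_singleton, Ideal.mem_span_singleton]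
        exact h1
      rw [hcount, hc] at h2
      omega
  · intro h p hp hpf'
    have key : ∀ P : Ideal R, P.IsPrime → P ≠ ⊥ → ¬ P ∣ Ideal.span {x} → ∀ k : ℕ,
        Ideal.span {(p : R)} = P ^ k → IsCoprime x (p : R) := by
      intro P hP hP0 hPx k hk
      have hmax := hP.isMaximal hP0
      rw [← Ideal.isCoprime_span_singleton_iff, hk]
      refine IsCoprime.pow_right ?_
      rw [isCoprime_comm, Ideal.isCoprime_iff_sup_eq]
      by_contra hne
      have h2 := hmax.eq_of_le hne le_sup_left
      exact hPx (Ideal.dvd_iff_le.2 (le_sup_right.trans h2.ge))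
    rcases hpf p hp hpf' with h1 | ⟨P, hP, hpP⟩
    · by_cases h2 : (p : R) ∣ x
      · exact Or.inr h2
      · left
        refine key _ h1 (by simpa using natCast_ne_zero_of_coords φ hp.ne_zero) ?_ 1 (pow_one _).symm
        rwa [Ideal.dvd_span_singleton, Ideal.mem_span_singleton]
    · have hPS : IsRamifiedPrimeOver f P := ⟨hP, p, hp, hpf', hpP⟩
      have hcount := Ideal.pow_dvd_iff_le_count_normalizedFactors (hPS.prime φ) hx'
      by_cases h2 : P ∣ Ideal.span {x}
      · right
        rw [← pow_one P, hcount] at h2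
        have := h P hPS
        have h3 := (hcount 2).2 (by omega)
        rwa [← hpP, Ideal.dvd_span_singleton, Ideal.mem_span_singleton] at h3
      · exact Or.inl (key P hP (hPS.prime φ).ne_zero h2 2 hpP)

include φ in
theorem balanced_normalizedFactors_iff (hPic : Nat.card (CommRing.Pic R) = 2)
    (hpf : ∀ p : ℕ, p.Prime → p ∣ f → (Ideal.span {(p : R)}).IsPrime ∨
      ∃ P : Ideal R, P.IsPrime ∧ Ideal.span {(p : R)} = P ^ 2) {x : R} (hx : x ≠ 0) :
    (normalizedFactors (Ideal.span {x})).Balanced (fun Q : Ideal R => ¬ Q.IsPrincipal)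
      (IsRamifiedPrimeOver f) ↔ AdmissibleAt f x := by
  classical
  rw [admissibleAt_iff_count_ne_one φ hpf hx]
  refine ⟨fun h P hP => by convert! h.2 P hP, fun h => ⟨?_, fun P hP => by convert! h P hP⟩⟩
  have h1 := Ideal.isPrincipal_prod_iff_even_countP hPic (normalizedFactors (Ideal.span {x}))
    fun Q hQ => prime_of_normalized_factor Q hQ
  rw [Ideal.prod_normalizedFactors_eq_self (by simpa using hx)] at h1
  convert! h1.1 ⟨⟨x, rfl⟩⟩

include φ in
theorem exists_normalizedFactors_eq (hPic : Nat.card (CommRing.Pic R) = 2)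
    (hpf : ∀ p : ℕ, p.Prime → p ∣ f → (Ideal.span {(p : R)}).IsPrime ∨
      ∃ P : Ideal R, P.IsPrime ∧ Ideal.span {(p : R)} = P ^ 2) {M : Multiset (Ideal R)}
    (hM : ∀ Q ∈ M, Prime Q)
    (hMb : M.Balanced (fun Q : Ideal R => ¬ Q.IsPrincipal) (IsRamifiedPrimeOver f)) :
    ∃ x : R, x ≠ 0 ∧ Ideal.span {x} = M.prod ∧ normalizedFactors (Ideal.span {x}) = M ∧
      AdmissibleAt f x := by
  classical
  obtain ⟨⟨x, hx⟩⟩ := (Ideal.isPrincipal_prod_iff_even_countP hPic M hM).2 (by convert! hMb.1)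
  rw [Ideal.submodule_span_eq] at hx
  have hprod : M.prod ≠ 0 := Multiset.prod_ne_zero fun h0 => (hM 0 h0).ne_zero rfl
  have hx0 : x ≠ 0 := by
    rintro rfl
    apply hprod
    rw [hx]
    simp
  have hfac : normalizedFactors (Ideal.span {x}) = M := by
    rw [← hx]
    exact normalizedFactors_prod_of_prime hM
  refine ⟨x, hx0, hx.symm, hfac, ?_⟩
  rw [← balanced_normalizedFactors_iff φ hPic hpf hx0, hfac]
  exact hMb

variable {O : Subring R}

theorem normalizedFactors_span_mul {x y : R} (hx : x ≠ 0) (hy : y ≠ 0) :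
    normalizedFactors (Ideal.span {x * y}) =
      normalizedFactors (Ideal.span {x}) + normalizedFactors (Ideal.span {y}) := by
  rw [← Ideal.span_singleton_mul_span_singleton,
    normalizedFactors_mul (by simpa using hx) (by simpa using hy)]

theorem normalizedFactors_span_units_mul (u : Rˣ) (x : R) :
    normalizedFactors (Ideal.span {u * x}) = normalizedFactors (Ideal.span {x}) := by
  rw [Ideal.span_singleton_mul_left_unit u.isUnit]

include φ in
-- For the splitting, both parts have principal products, with admissible generators `x` and `y`. A
-- unit `v` corrects their product to `a`, and `exists_unit_mul_mem_and_inv_mul_mem` then moves `x`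
-- and `vy` into `O` by inverse units.
theorem balancedTransfer_normalizedFactors (hf : Squarefree f)
    (hO : ∀ x, x ∈ O ↔ (f : ℤ) ∣ (φ x).im)
    (hu : ∀ x : R, IsCoprime x (f : R) → ∃ u : Rˣ, u * x ∈ O)
    (hPic : Nat.card (CommRing.Pic R) = 2)
    (hpf : ∀ p : ℕ, p.Prime → p ∣ f → (Ideal.span {(p : R)}).IsPrime ∨
      ∃ P : Ideal R, P.IsPrime ∧ Ideal.span {(p : R)} = P ^ 2) :
    BalancedTransfer (H := O⁰) (fun Q : Ideal R => ¬ Q.IsPrincipal) (IsRamifiedPrimeOver f)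
      fun a => normalizedFactors (Ideal.span {((a : O) : R)}) := by
  have hne : ∀ a : O⁰, ((a : O) : R) ≠ 0 := fun a h =>
    nonZeroDivisors.coe_ne_zero a (Subtype.ext h)
  refine ⟨fun a b => ?_, fun a => ?_, fun a => ?_, fun a A B hAB hA hB => ?_⟩
  · exact normalizedFactors_span_mul (hne a) (hne b)
  · rw [normalizedFactors_eq_zero_iff (by simp), Ideal.isUnit_iff,
      Ideal.span_singleton_eq_top]
    constructor
    · intro h
      obtain ⟨b, hb⟩ := (isUnit_of_isUnit_coe φ hf hO h).exists_right_inv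
      have hb0 : b ∈ O⁰ := by
        refine mem_nonZeroDivisors_of_ne_zero ?_
        rintro rfl
        simp at hb
      exact IsUnit.of_mul_eq_one ⟨b, hb0⟩ (Subtype.ext hb)
    · intro h
      exact (h.map (Submonoid.subtype O⁰)).map O.subtype
  · exact (balanced_normalizedFactors_iff φ hPic hpf (hne a)).2
      (admissibleAt_of_mem φ hO (a : O).2)
  · have hprime : ∀ Q ∈ A + B, Prime Q := fun Q hQ => prime_of_normalized_factor Q (hAB ▸ hQ)
    obtain ⟨x, hx0, hxA, hxf, hxa⟩ := exists_normalizedFactors_eq φ hPic hpf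
      (fun Q hQ => hprime Q (Multiset.mem_add.2 (Or.inl hQ))) hA
    obtain ⟨y, hy0, hyB, hyf, hya⟩ := exists_normalizedFactors_eq φ hPic hpf
      (fun Q hQ => hprime Q (Multiset.mem_add.2 (Or.inr hQ))) hB
    have h1 : Ideal.span {x * y} = Ideal.span {((a : O) : R)} := by
      rw [← Ideal.span_singleton_mul_span_singleton, hxA, hyB, ← Multiset.prod_add, ← hAB,
        Ideal.prod_normalizedFactors_eq_self (by simp)]
    obtain ⟨v, hv⟩ := Ideal.span_singleton_eq_span_singleton.1 h1
    have hxy : x * (v * y) = ((a : O) : R) := by rw [← hv]; ring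
    have hvf : normalizedFactors (Ideal.span {v * y}) = B := by
      rw [normalizedFactors_span_units_mul, hyf]
    have hvy0 : (v : R) * y ≠ 0 := mul_ne_zero v.ne_zero hy0
    obtain ⟨u, hux, huy⟩ := exists_unit_mul_mem_and_inv_mul_mem φ hf hO hu hxa
      ((balanced_normalizedFactors_iff φ hPic hpf hvy0).1 (hvf ▸ hB)) (hxy ▸ (a : O).2)
    refine ⟨⟨⟨u * x, hux⟩, mem_nonZeroDivisors_of_ne_zero ?_⟩,
      ⟨⟨(u⁻¹ : Rˣ) * (v * y), huy⟩, mem_nonZeroDivisors_of_ne_zero ?_⟩, ?_, ?_, ?_⟩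
    · exact fun h => mul_ne_zero u.ne_zero hx0 (congrArg Subtype.val h)
    · exact fun h => mul_ne_zero (u⁻¹).ne_zero hvy0 (congrArg Subtype.val h)
    · apply Subtype.ext
      apply Subtype.ext
      change ((a : O) : R) = u * x * ((u⁻¹ : Rˣ) * (v * y))
      rw [mul_mul_mul_comm, Units.mul_inv, one_mul, hxy]
    · change normalizedFactors (Ideal.span {u * x}) = A
      rw [normalizedFactors_span_units_mul, hxf]
    · change normalizedFactors (Ideal.span {(u⁻¹ : Rˣ) * (v * y)}) = B
      rw [normalizedFactors_span_units_mul, hvf]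

end IdealFactorization

/-! ### A nonprincipal nonspecial prime, and the conclusion -/

section Main

open UniqueFactorizationMonoid QuadOrder

/-- Take `z` divisible by `P` exactly once and congruent to `1` modulo every other prime divisor of
`f`. If all nonprincipal primes were special, `P` would be the only nonprincipal factor of `(z)`,
with odd multiplicity, although `(z)` is principal. -/
theorem exists_prime_not_isPrincipal_not_isRamifiedPrimeOver {R : Type*} [CommRing R]
    [IsDedekindDomain R] {n t : ℤ} (φ : R ≃+* QuadraticAlgebra ℤ n t) {f : ℕ} (hf : f ≠ 0)
    (hPic : Nat.card (CommRing.Pic R) = 2)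
    (hS : ∀ Q : Ideal R, IsRamifiedPrimeOver f Q → ¬ Q.IsPrincipal)
    {P : Ideal R} (hP : IsRamifiedPrimeOver f P) :
    ∃ Q : Ideal R, Prime Q ∧ ¬ Q.IsPrincipal ∧ ¬ IsRamifiedPrimeOver f Q := by
  classical
  have hPprime := hP.prime φ
  obtain ⟨hPp, p, hp, hpf, hpP⟩ := id hP
  obtain ⟨a, haP, haP2⟩ := Ideal.exists_mem_pow_notMem_pow_succ P hPprime.ne_zero hPp.ne_top 1
  rw [pow_one] at haP
  obtain ⟨z, hz⟩ := exists_forall_prime_dvd_sub hf fun q => if q = p then a else 1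
  have hzp : z - a ∈ P ^ 2 := by
    rw [← hpP, Ideal.mem_span_singleton]
    simpa using hz p hp hpf
  have hzP : z ∈ P := by
    have := P.add_mem (Ideal.pow_le_self two_ne_zero hzp) haP
    simpa using this
  have hzP2 : z ∉ P ^ 2 := fun h => haP2 (by simpa using Ideal.sub_mem _ h hzp)
  have hz0 : z ≠ 0 := by
    rintro rfl
    exact hzP2 (Ideal.zero_mem _)
  have hz0' : Ideal.span {z} ≠ 0 := by simpa using hz0
  have hcount := Ideal.pow_dvd_iff_le_count_normalizedFactors hPprime hz0'
  have hc : (normalizedFactors (Ideal.span {z})).count P = 1 := by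
    have h1 := hcount 1
    have h2 := hcount 2
    rw [Ideal.dvd_span_singleton] at h1 h2
    rw [pow_one] at h1
    have := h1.1 hzP
    have := mt h2.2 hzP2
    omega
  have heven := Ideal.isPrincipal_prod_iff_even_countP hPic (normalizedFactors (Ideal.span {z}))
    fun Q hQ => prime_of_normalized_factor Q hQ
  rw [Ideal.prod_normalizedFactors_eq_self hz0'] at heven
  have heven := heven.1 ⟨⟨z, rfl⟩⟩
  by_contra! hcon
  have hall : ∀ Q ∈ normalizedFactors (Ideal.span {z}), ¬ Q.IsPrincipal ↔ P = Q := by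
    intro Q hQ
    refine ⟨fun hQp => ?_, fun h => h ▸ hS P hP⟩
    obtain ⟨hQprime, q, hq, hqf, hqQ⟩ := hcon Q (prime_of_normalized_factor Q hQ) hQp
    have hzQ : z ∈ Q := Ideal.dvd_span_singleton.1 (dvd_of_mem_normalizedFactors hQ)
    by_cases hqp : q = p
    · subst hqp
      rw [hpP] at hqQ
      exact pow_left_injective two_ne_zero hqQ
    · exfalso
      have h1 := hz q hq hqf
      rw [if_neg hqp, ← Ideal.mem_span_singleton, hqQ] at h1
      apply hQprime.ne_top
      rw [Ideal.eq_top_iff_one]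
      simpa using Q.sub_mem hzQ (Ideal.pow_le_self two_ne_zero h1)
  rw [Multiset.countP_congr rfl fun Q hQ => propext (hall Q hQ)] at heven
  change Even (Multiset.count P _) at heven
  rw [hc] at heven
  exact absurd heven (by decide)

theorem QuadOrder.IsRamifiedTimesInert.squarefree {K : Type*} [Field K] [NumberField K] {f : ℕ}
    (hf : IsRamifiedTimesInert K f) : Squarefree f ∧ (∃ p, p ∣ f ∧ IsRamified K p) ∧
      ∀ p : ℕ, p.Prime → p ∣ f → IsRamified K p ∨ IsInert K p := by
  classical
  obtain ⟨S, T, hSne, hS, hT, rfl⟩ := hf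
  -- If `p` were both ramified and inert, the square `P²` would be a prime ideal.
  have hdisj : Disjoint S T := by
    rw [Finset.disjoint_left]
    intro p hpS hpT
    obtain ⟨hp, P, hP, hpP⟩ := hS p hpS
    have h1 := (hT p hpT).2
    have hP0 : P ≠ ⊥ := by
      rintro rfl
      rw [Ideal.bot_pow two_ne_zero, Ideal.span_singleton_eq_bot] at hpP
      exact hp.ne_zero (by exact_mod_cast hpP)
    rw [hpP] at h1
    have h2 := Ideal.prime_of_isPrime (pow_ne_zero 2 hP0) h1
    exact not_irreducible_pow (by norm_num) h2.irreducible
  have hprime : ∀ p ∈ S ∪ T, p.Prime := by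
    intro p hp
    rcases Finset.mem_union.1 hp with h | h
    · exact (hS p h).1
    · exact (hT p h).1
  rw [← Finset.prod_union hdisj]
  refine ⟨?_, ?_, ?_⟩
  · refine Finset.squarefree_prod_of_pairwise_isCoprime ?_ fun p hp =>
      (hprime p hp).prime.squarefree
    intro p hp q hq hpq
    exact Nat.coprime_iff_isRelPrime.1 ((Nat.coprime_primes (hprime p hp) (hprime q hq)).2 hpq)
  · obtain ⟨p, hp⟩ := hSne
    exact ⟨p, Finset.dvd_prod_of_mem _ (Finset.mem_union_left T hp), hS p hp⟩
  · intro p hp hpf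
    obtain ⟨q, hq, hpq⟩ := (hp.prime.dvd_finsetProd_iff _).1 hpf
    rw [(Nat.prime_dvd_prime_iff_eq hp (hprime q hq)).1 hpq]
    exact (Finset.mem_union.1 hq).imp (hS q) (hT q)

end Main

theorem proposition4p19 (d : ℕ) (hd : 2 ≤ d) (hdsq : Squarefree d)
    -- the field `K = ℚ(√d)`
    (K : Type*) [Field K] [NumberField K]
    (hK : ∃ s : K, s ^ 2 = (d : K) ∧ IntermediateField.adjoin ℚ {s} = ⊤)
    (f : ℕ) (hf : QuadOrder.IsRamifiedTimesInert K f)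
    -- the order in `K` with conductor `f 𝓞_K`
    (O : Subring (𝓞 K)) (hO : QuadOrder.IsOrder O)
    (hcond : QuadOrder.orderConductor O = Ideal.span {(f : 𝓞 K)})
    (hPicO : Nat.card (CommRing.Pic O) = 2)
    (hPicK : Nat.card (CommRing.Pic (𝓞 K)) = 2)
    -- at the odd primes `p` and `q` that occur here the quadratic symbol is `jacobiSym`
    (hram : ∀ p : ℕ, QuadOrder.IsRamified K p → p ∣ f →
      (p % 4 = 1 ∧ jacobiSym ((d / p : ℕ) : ℤ) p = -1) ∨
      (∃ q : ℕ, q.Prime ∧ q % 4 = 1 ∧ q ∣ d * f ∧ jacobiSym (p : ℤ) q = -1)) :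
    IsLeast (QuadOrder.ringDistances O) 2 := by
  obtain ⟨s, hs, htop⟩ := hK
  obtain ⟨n, t, ⟨φ⟩⟩ := exists_ringEquiv_quadraticAlgebra
    (finrank_eq_two_of_sq_eq (not_isSquare_of_squarefree hd hdsq) hs htop)
  obtain ⟨hfsq, ⟨p₀, hp₀f, hp₀⟩, hsplit⟩ := hf.squarefree
  have hmem := QuadOrder.mem_order_iff_dvd_im φ hcond
  have hdns := not_isSquare_of_squarefree hd hdsq
  obtain ⟨s', hs'⟩ : ∃ s' : 𝓞 K, s' ^ 2 = (d : 𝓞 K) := by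
    have hint : IsIntegral ℤ s := by
      refine IsIntegral.of_pow two_pos ?_
      rw [hs]
      exact_mod_cast isIntegral_algebraMap (R := ℤ) (A := K) (x := (d : ℤ))
    obtain ⟨s', rfl⟩ : ∃ s' : 𝓞 K, (s' : K) = s := ⟨⟨s, hint⟩, rfl⟩
    refine ⟨s', NumberField.RingOfIntegers.ext ?_⟩
    exact_mod_cast hs
  have hu : ∀ x : 𝓞 K, IsCoprime x (f : 𝓞 K) → ∃ u : (𝓞 K)ˣ, u * x ∈ O := by
    intro x hx
    refine exists_unit_mul_mem_of_card_pic_eq_two (F := Ideal.span {(f : 𝓞 K)}) ?_ ?_ ?_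
      hPicO hPicK ?_
    · intro y hy
      rw [hmem]
      exact dvd_im_of_natCast_dvd φ (Ideal.mem_span_singleton.1 hy)
    · simpa using hfsq.ne_zero
    · rw [ne_eq, Ideal.span_singleton_eq_top]
      exact fun h => not_isUnit_natCast_of_prime φ hp₀.1
        (isUnit_of_dvd_unit (Nat.cast_dvd_cast hp₀f) h)
    · rwa [← Ideal.isCoprime_iff_sup_eq, Ideal.isCoprime_span_singleton_iff]
  have hS : ∀ Q : Ideal (𝓞 K), IsRamifiedPrimeOver f Q → ¬ Q.IsPrincipal := by
    rintro Q ⟨hQ, p, hp, hpf, hpQ⟩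
    exact not_isPrincipal_of_span_eq_sq φ hs' hdns hdsq hfsq hmem hu hp
      (hram p ⟨hp, Q, hQ, hpQ⟩ hpf) hpQ
  have hpf : ∀ p : ℕ, p.Prime → p ∣ f → (Ideal.span {(p : 𝓞 K)}).IsPrime ∨
      ∃ P : Ideal (𝓞 K), P.IsPrime ∧ Ideal.span {(p : 𝓞 K)} = P ^ 2 := fun p hp hpf =>
    (hsplit p hp hpf).elim (fun h => Or.inr h.2) fun h => Or.inl h.2
  have hT := balancedTransfer_normalizedFactors φ hfsq hmem hu hPicK hpf
  obtain ⟨hp₀p, P, hP, hpP⟩ := hp₀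
  have hPS : IsRamifiedPrimeOver f P := ⟨hP, p₀, hp₀p, hp₀f, hpP⟩
  obtain ⟨Q, hQprime, hQN, hQS⟩ :=
    exists_prime_not_isPrincipal_not_isRamifiedPrimeOver φ hfsq.ne_zero hPicK hS hPS
  -- `P³Q` has four nonprincipal factors, and its only special prime `P` occurs three times.
  have hb : (Multiset.replicate 3 P + {Q}).Balanced (fun Q : Ideal (𝓞 K) => ¬ Q.IsPrincipal)
      (IsRamifiedPrimeOver f) := by
    classical
    refine Multiset.balanced_of_forall_mem ?_ (by simp; decide) fun Z hZ => ?_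
    · intro Z hZ
      rcases Multiset.mem_add.1 hZ with h | h
      · rw [Multiset.eq_of_mem_replicate h]
        exact hS P hPS
      · rw [Multiset.mem_singleton.1 h]
        exact hQN
    · have hZQ : Z ≠ Q := by
        rintro rfl
        exact hQS hZ
      rw [Multiset.count_add, Multiset.count_replicate, Multiset.count_singleton, if_neg hZQ]
      split_ifs <;> omega
  obtain ⟨x, hx0, -, hxf, hxa⟩ := exists_normalizedFactors_eq φ hPicK hpf (by
    intro Z hZ
    rcases Multiset.mem_add.1 hZ with h | h
    · rw [Multiset.eq_of_mem_replicate h]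
      exact hPS.prime φ
    · rw [Multiset.mem_singleton.1 h]
      exact hQprime) hb
  obtain ⟨u, hux⟩ := exists_unit_mul_mem_of_admissibleAt φ hfsq hmem hu hxa
  have hux0 : (⟨u * x, hux⟩ : O) ∈ O⁰ := by
    refine mem_nonZeroDivisors_of_ne_zero fun h => ?_
    exact mul_ne_zero u.ne_zero hx0 (congrArg Subtype.val h)
  refine hT.isLeast_monoidDistances (a := ⟨⟨u * x, hux⟩, hux0⟩) hS hPS hQN hQS ?_
  change UniqueFactorizationMonoid.normalizedFactors (Ideal.span {u * x}) = _
  rw [normalizedFactors_span_units_mul, hxf]
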